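/- **Setting.** Fix a perturbative theory: a dimension $D$, field types with an involution $\varphi\mapsto\bar\varphi$ (type of the other end of an edge) and propagator weights, and a finite set of Lagrangian monomials $P$, each with a multiset of at least two field types, a powercounting weight, and, for every finite set $L$ of legs, an external structure $\sigma_{P,L}$. Half-edges are labelled by a field type and an integer. A *graph* has vertices (sets of half-edges, pairwise disjoint, each marked by a monomial with the same field types) and internal edges (pairs of half-edges of types $\varphi,\bar\varphi$), without self-loops; the half-edges in no internal edge are its legs. *1PI* means: connected after removal of any internal edge, at least two vertices and at least two legs. The degree of divergence is $\omega(\Gamma)=D\ell-\sum_e w_e+\sum_v w_v$, with $\ell$ the loop number. A graph with two legs is a *self-energy*, one with more legs a *vertex graph*. For a set $L$ of legs let $E_L$ be the space of smooth complex functions of momenta $p_f\in\mathbb R^D$ ($f\in L$) with $\sum_f p_f=0$. An *external structure* on $L$ is a compactly supported distribution $\sigma$ on this momentum space, i.e. a continuous linear functional on $E_L$. A pair $(\Gamma,\sigma)$, linear in $\sigma$, is a *specified graph*; it is *superficially convergent* if $\sigma$ annihilates all polynomials of degree $\le\omega(\Gamma)$, and otherwise superficially divergent. A *part* of $\Gamma$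 is a proper 1PI subgraph $\gamma$ (the full subgraph on a set of vertices), with $\omega(\gamma)\ge0$, whose residue matches a monomial $P$ of the Lagrangian (same external fields, weight $\omega(\gamma)$). In sums, $\gamma\subset\Gamma$ runs over the nonempty disjoint unions of parts. **Change of external structures.** Let $\Theta$ be given by linear maps $\sigma\mapsto\Theta(\sigma)$ of the external structures on every set of legs, such that (i) $\Theta$ is the identity for two legs; (ii) $\Theta$ is not the identity on the legs of any superficially divergent 1PI vertex graph ($\omega\ge 0$); (iii) for every 1PI vertex graph $\Gamma$, $\Theta(\sigma)$ and $\sigma$ agree on polynomials of degree $\le\omega(\Gamma)$. A subgraph of a graph may be *coloured*, meaning that it is inserted with its external structure changed by $\Theta$. Put $\Theta(\Gamma,\sigma)=(\Gamma,\Theta(\sigma))$; for a graph that is later inserted into another one this colours the whole graph, and it does nothing where $\Theta$ is the identity. Define recursively $$S_\Theta(\Gamma)=-\Theta\Big[\Gamma+\sum_{\gamma\subset\Gamma}\Gamma/\gamma\star_{G}S_\Theta(\gamma)\Big],\qquad (S_\Theta\star\mathrm{id})(\Gamma)=S_\Theta(\Gamma)+\Gamma+\sum_{\gamma\subset\Gamma}\Gamma/\gamma\star_{G}S_\Theta(\gamma),$$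 where $S_\Theta$ is multiplicative on disjoint unions and $\star_G$ glues the (coloured) components of $\gamma$ back at their places in $\Gamma/\gamma$. **Bidegree.** Let $\mathcal H$ be the commutative algebra freely generated by coloured 1PI specified graphs $(\Gamma,\sigma)$, linear in $\sigma$; the coloured subgraphs are proper, 1PI and pairwise disjoint or nested. Its coproduct is the algebra homomorphism with $$\Delta(\Gamma,\sigma)=(\Gamma,\sigma)\otimes1+1\otimes(\Gamma,\sigma)+\sum_{\gamma\subset\Gamma}\sum_{P}\prod_j(\gamma_j,\sigma_j)\otimes(\Gamma/\gamma_{(P)},\sigma).$$ Here $\gamma=\bigsqcup_j\gamma_j$ runs over those unions of parts no component of which overlaps a coloured subgraph, and $P=(P_j)$ over the choices of a monomial $P_j$ matching $\gamma_j$, which marks the vertex to which $\gamma_j$ is shrunk. The external structure $\sigma_j$ is that of $P_j$ on the legs of $\gamma_j$, changed by $\Theta$ if $\gamma_j$ is coloured. The colours strictly inside $\gamma_j$ go to $\gamma_j$, and the colours not contained in a $\gamma_j$ go to $\Gamma/\gamma$. Let $\pi:\mathcal H\to\overline{\mathcal H}$ be the quotient by the ideal generated by the superficially convergent specified graphs,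 and $\delta(X)=(\pi\otimes\mathrm{id})\Delta(X)-1\otimes X\in\overline{\mathcal H}\otimes\mathcal H$. Then $\mathrm{bid}(X)$ is the least $n$ such that $n+1$ successive applications of $\delta$ (each to the last tensor factor) annihilate $X$. Thus convergent specified graphs without divergent subgraphs have bidegree $0$, and superficially divergent ones without divergent subgraphs have bidegree $1$. **Theorem.** Let $\Gamma$ be a 1PI graph such that no self-energy part of $\Gamma$ overlaps another part of $\Gamma$ (any two such are disjoint or nested), and let $\sigma$ be an external structure on its legs. 1. $\mathrm{bid}\big((S_\Theta\star\mathrm{id})(\Gamma,\sigma)\big)=0$. 2. If all parts of $\Gamma$ are vertex graphs and $(\Gamma,\sigma)$ is superficially divergent, then $\mathrm{bid}\big(S_\Theta(\Gamma,\sigma)\big)=1$. 3. If some part of $\Gamma$ is a self-energy, then $S_\Theta(\Gamma,\sigma)=0$. -/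

import Mathlib

open scoped TensorProduct ContDiff

noncomputable section

namespace FeynmanGraphs

/-! ### External structures -/

/-- External momenta `p_f`, one vector of `ℝ^D` for each leg `f ∈ L`, with `∑ p_f = 0`. -/
def Momenta (D : ℕ) {ι : Type} (L : Finset ι) : Submodule ℝ (L → EuclideanSpace ℝ (Fin D)) :=
  LinearMap.ker (∑ f : L, LinearMap.proj (R := ℝ) (φ := fun _ : L => EuclideanSpace ℝ (Fin D)) f)

theorem mem_momenta {D : ℕ} {ι : Type} {L : Finset ι} (p : L → EuclideanSpace ℝ (Fin D)) :
    p ∈ Momenta D L ↔ ∑ f, p f = 0 := by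
  simp [Momenta]

/-- The space `E_L` of (smooth, complex valued) functions of the external momenta. -/
def MomentumFn (D : ℕ) {ι : Type} (L : Finset ι) : Submodule ℂ (Momenta D L → ℂ) where
  carrier := {f | ContDiff ℝ ∞ f}
  add_mem' := by
    intro f g hf hg
    exact ContDiff.add (Set.mem_ofPred_eq ▸ hf) (Set.mem_ofPred_eq ▸ hg)
  zero_mem' := Set.mem_ofPred_eq ▸ contDiff_const
  smul_mem' := by
    intro c f hf
    exact ContDiff.const_smul c (Set.mem_ofPred_eq ▸ hf)

/-- External structures: the continuous linear functionals on `E_L = C^∞`, that is, the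
distributions with compact support. Continuity is expressed by the usual seminorm bound. -/
def ExtStr (D : ℕ) {ι : Type} (L : Finset ι) : Submodule ℂ (Module.Dual ℂ (MomentumFn D L)) where
  carrier := {σ | ∃ K : Set (Momenta D L), IsCompact K ∧ ∃ (N : ℕ) (C : ℝ), ∀ (f : MomentumFn D L)
    (M : ℝ), (∀ n ≤ N, ∀ x ∈ K, ‖iteratedFDeriv ℝ n f.1 x‖ ≤ M) → ‖σ f‖ ≤ C * M}
  add_mem' := by
    rintro σ τ ⟨K, hK, N, C, h⟩ ⟨K', hK', N', C', h'⟩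
    refine ⟨K ∪ K', hK.union hK', max N N', C + C', fun f M hM => ?_⟩
    have h1 := h f M fun n hn x hx => hM n (hn.trans (le_max_left _ _)) x (Or.inl hx)
    have h2 := h' f M fun n hn x hx => hM n (hn.trans (le_max_right _ _)) x (Or.inr hx)
    calc ‖(σ + τ) f‖ ≤ ‖σ f‖ + ‖τ f‖ := norm_add_le _ _
      _ ≤ (C + C') * M := by linarith
  zero_mem' := ⟨∅, isCompact_empty, 0, 0, fun f M _ => by simp⟩
  smul_mem' := by
    rintro c σ ⟨K, hK, N, C, h⟩
    refine ⟨K, hK, N, ‖c‖ * C, fun f M hM => ?_⟩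
    have h1 := h f M hM
    calc ‖(c • σ) f‖ = ‖c‖ * ‖σ f‖ := by simp
      _ ≤ ‖c‖ * (C * M) := by gcongr
      _ = ‖c‖ * C * M := by ring

/-- `f` is a polynomial in the external momenta, of degree at most `d`. -/
def IsPolyOfDegreeLE {D : ℕ} {ι : Type} {L : Finset ι} (f : MomentumFn D L) (d : ℝ) : Prop :=
  ∃ p : MvPolynomial (L × Fin D) ℂ, (p.totalDegree : ℝ) ≤ d ∧
    ∀ q : Momenta D L, f.1 q = p.eval (fun i => ((q.1 i.1 i.2 : ℝ) : ℂ))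

/-! ### Field theories and graphs -/

/-- The combinatorial data of a perturbative quantum field theory. A half-edge is labelled by a
type of field and a natural number; `bar φ` is the type of the other end of an edge that starts
as `φ` (for unoriented edges `bar φ = φ`). `extStr P L` is the external structure that projects
onto the field monomial `P`, for graphs whose set of legs is `L`. -/
structure QFT where
  /-- space-time dimension -/
  D : ℕ
  /-- types of half-edges -/
  Fld : Type
  bar : Fld → Fld
  bar_bar : ∀ φ, bar (bar φ) = φ
  /-- scaling degree of the inverse propagator -/
  propWeight : Fld → ℝ
  propWeight_bar : ∀ φ, propWeight (bar φ) = propWeight φ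
  /-- the monomials of the Lagrangian -/
  Mono : Type
  finMono : Fintype Mono
  /-- field degree of a monomial -/
  fields : Mono → Multiset Fld
  two_le_card_fields : ∀ P, 2 ≤ (fields P).card
  /-- contribution of a vertex of the given kind to powercounting -/
  monoWeight : Mono → ℝ
  extStr : Mono → ∀ L : Finset (Fld × ℕ), ExtStr D L

attribute [instance] QFT.finMono

/-- Half-edges. -/
abbrev QFT.HalfEdge (T : QFT) : Type := T.Fld × ℕ

/-- A vertex is the set of half-edges attached to it, together with its kind. -/
abbrev QFT.Vertex (T : QFT) : Type := Finset T.HalfEdge × T.Mono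

variable {T : QFT}

/-- Raw data of a graph: vertices, and internal edges (pairs of half-edges). -/
@[ext]
structure Graph (T : QFT) where
  verts : Finset T.Vertex
  edges : Finset (Finset T.HalfEdge)

namespace Graph

open scoped Classical in
/-- All half-edges of a graph. -/
def halves (Γ : Graph T) : Finset T.HalfEdge := Γ.verts.biUnion Prod.fst

open scoped Classical in
/-- The external edges: the half-edges that belong to no internal edge. This set of half-edges is
also the residue of the graph, i.e. the vertex that is left when the graph is shrunk to a point. -/
def legs (Γ : Graph T) : Finset T.HalfEdge := Γ.halves \ Γ.edges.biUnion id

/-- The raw data form a graph of the theory, without self-loops. -/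
structure IsFeynman (Γ : Graph T) : Prop where
  verts_disjoint : ∀ v ∈ Γ.verts, ∀ w ∈ Γ.verts, v ≠ w → Disjoint v.1 w.1
  verts_kind : ∀ v ∈ Γ.verts, v.1.val.map Prod.fst = T.fields v.2
  edges_pair : ∀ e ∈ Γ.edges, ∃ h ∈ Γ.halves, ∃ h' ∈ Γ.halves,
    h ≠ h' ∧ h'.1 = T.bar h.1 ∧ ∀ x, x ∈ e ↔ x = h ∨ x = h'
  edges_disjoint : ∀ e ∈ Γ.edges, ∀ e' ∈ Γ.edges, e ≠ e' → Disjoint e e'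
  no_self_loop : ∀ e ∈ Γ.edges, ∀ v ∈ Γ.verts, ¬ e ⊆ v.1

/-- Two vertices are joined by an edge from the set `R`. -/
def Joined (R : Finset (Finset T.HalfEdge)) (v w : T.Vertex) : Prop :=
  ∃ e ∈ R, ∃ h ∈ e, ∃ h' ∈ e, h ∈ v.1 ∧ h' ∈ w.1

open scoped Classical in
/-- `n`-particle irreducibility: the graph stays connected on removal of up to `n` edges. -/
def IsNPI (n : ℕ) (Γ : Graph T) : Prop :=
  Γ.verts.Nonempty ∧ ∀ R ⊆ Γ.edges, R.card ≤ n → ∀ v ∈ Γ.verts, ∀ w ∈ Γ.verts,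
    Relation.ReflTransGen
      (fun a b => a ∈ Γ.verts ∧ b ∈ Γ.verts ∧ Joined (Γ.edges \ R) a b) v w

/-- The 1PI graphs of the theory: neither a bare vertex, nor a vacuum graph, nor a tadpole. -/
structure Is1PI (Γ : Graph T) : Prop where
  feynman : Γ.IsFeynman
  npi : Γ.IsNPI 1
  two_le_verts : 2 ≤ Γ.verts.card
  two_le_legs : 2 ≤ Γ.legs.card

/-- Number of independent loops of a connected graph. -/
def loops (Γ : Graph T) : ℝ := Γ.edges.card - Γ.verts.card + 1

/-- Superficial degree of divergence, by powercounting (each half-edge carries half of the weight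
of its edge). -/
def degree (Γ : Graph T) : ℝ :=
  T.D * Γ.loops - ∑ e ∈ Γ.edges, ∑ h ∈ e, T.propWeight h.1 / 2 + ∑ v ∈ Γ.verts, T.monoWeight v.2

open scoped Classical in
/-- The subgraph of `Γ` on a set `S` of vertices of `Γ`: its internal edges are the edges of `Γ`
between vertices of `S`; an edge of `Γ` that leaves `S` becomes an external edge. As self-loops
are excluded, the connected subgraphs that can be shrunk to a point are of this form. -/
def sub (Γ : Graph T) (S : Finset T.Vertex) : Graph T where
  verts := S
  edges := Γ.edges.filter (fun e => e ⊆ S.biUnion Prod.fst)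

open scoped Classical in
/-- The monomials of the Lagrangian that match the residue of a graph: same external fields, and
the same degree for powercounting. -/
def monomials (Γ : Graph T) : Finset T.Mono :=
  Finset.univ.filter (fun P => T.fields P = Γ.legs.val.map Prod.fst ∧ T.monoWeight P = Γ.degree)

open scoped Classical in
/-- The proper superficially divergent 1PI subgraphs (given by their sets of vertices), with
residue in the Lagrangian. -/
def parts (Γ : Graph T) : Finset (Finset T.Vertex) :=
  Γ.verts.powerset.filter (fun S =>
    S ≠ Γ.verts ∧ (Γ.sub S).Is1PI ∧ 0 ≤ (Γ.sub S).degree ∧ (Γ.sub S).monomials.Nonempty)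

open scoped Classical in
/-- The (nonempty) disjoint unions `γ ⊂ Γ` of proper superficially divergent 1PI subgraphs, each
given by the set of its connected components. -/
def subdivergences (Γ : Graph T) : Finset (Finset (Finset T.Vertex)) :=
  Γ.parts.powerset.filter (fun s =>
    s.Nonempty ∧ ∀ S ∈ s, ∀ S' ∈ s, S ≠ S' → Disjoint S S')

open scoped Classical in
/-- The cograph `Γ/γ`: every component `S` of `γ` is shrunk to a vertex whose half-edges are the
legs of `S` and whose kind is `c S`. -/
def contract (Γ : Graph T) (s : Finset (Finset T.Vertex)) (c : ∀ S ∈ s, T.Mono) : Graph T where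
  verts := (Γ.verts \ s.biUnion id) ∪ s.attach.image (fun S => ((Γ.sub S.1).legs, c S.1 S.2))
  edges := Γ.edges \ s.biUnion (fun S => (Γ.sub S).edges)

theorem monomials_nonempty {Γ : Graph T} {s : Finset (Finset T.Vertex)}
    (hs : s ∈ Γ.subdivergences) {S : Finset T.Vertex} (hS : S ∈ s) :
    (Γ.sub S).monomials.Nonempty := by
  classical
  simp only [subdivergences, Finset.mem_filter, Finset.mem_powerset] at hs
  have := hs.1 hS
  simp only [parts, Finset.mem_filter] at this
  exact this.2.2.2.2

theorem card_sub_lt {Γ : Graph T} {s : Finset (Finset T.Vertex)}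
    (hs : s ∈ Γ.subdivergences) {S : Finset T.Vertex} (hS : S ∈ s) :
    (Γ.sub S).verts.card < Γ.verts.card := by
  classical
  simp only [subdivergences, Finset.mem_filter, Finset.mem_powerset] at hs
  have := hs.1 hS
  simp only [parts, Finset.mem_filter, Finset.mem_powerset] at this
  exact Finset.card_lt_card (lt_of_le_of_ne this.1 this.2.1)

end Graph

/-- Two sets of vertices do not overlap: they are disjoint or nested. -/
def NonOverlapping (S S' : Finset T.Vertex) : Prop := S ⊆ S' ∨ S' ⊆ S ∨ Disjoint S S'

/-! ### Change of external structures and coloured graphs -/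

/-- A change `(Γ,σ) ↦ (Γ,Θ(σ))` of external structures: trivial for two external legs, nontrivial
on superficially divergent interaction graphs, and such that on interaction graphs it does not
modify the terms of the Taylor expansion in the external momenta that are divergent by
powercounting. -/
structure ExternalChange (T : QFT) where
  map : ∀ L : Finset T.HalfEdge, ExtStr T.D L →ₗ[ℂ] ExtStr T.D L
  trivial_on_selfEnergy : ∀ L, L.card = 2 → map L = LinearMap.id
  nontrivial_on_vertex : ∀ Γ : Graph T, Γ.Is1PI → 2 < Γ.legs.card → 0 ≤ Γ.degree →
    map Γ.legs ≠ LinearMap.id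
  preserves_divergence : ∀ Γ : Graph T, Γ.Is1PI → 2 < Γ.legs.card →
    ∀ (σ : ExtStr T.D Γ.legs) (f : MomentumFn T.D Γ.legs), IsPolyOfDegreeLE f Γ.degree →
      (map Γ.legs σ).1 f = σ.1 f

/-- A graph together with a set of coloured subgraphs. A coloured proper subgraph enters the graph
with its external structure changed by `Θ`. The whole set of vertices may be coloured as well,
which means that the external structure of the graph itself is to be changed by `Θ`. -/
@[ext]
structure CGraph (T : QFT) where
  graph : Graph T
  colours : Finset (Finset T.Vertex)

namespace CGraph

/-- The coloured graphs that can carry an external structure: the underlying graph is 1PI, and the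
coloured subgraphs are proper, 1PI, and pairwise disjoint or nested. -/
structure Good (c : CGraph T) : Prop where
  is1PI : c.graph.Is1PI
  colours_proper : ∀ φ ∈ c.colours, φ ⊂ c.graph.verts
  colours_1PI : ∀ φ ∈ c.colours, (c.graph.sub φ).Is1PI
  colours_nested : ∀ φ ∈ c.colours, ∀ ψ ∈ c.colours, NonOverlapping φ ψ

open scoped Classical in
/-- Remove the colour of the whole graph. -/
def inner (c : CGraph T) : CGraph T := ⟨c.graph, c.colours.erase c.graph.verts⟩

open scoped Classical in
/-- The coloured subgraph on `S`, with the coloured subgraphs strictly inside `S`. -/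
def sub (c : CGraph T) (S : Finset T.Vertex) : CGraph T :=
  ⟨c.graph.sub S, c.colours.filter (fun φ => φ ⊂ S)⟩

open scoped Classical in
/-- The coloured cograph: colours inside a shrunken component disappear, the others survive. -/
def contract (c : CGraph T) (s : Finset (Finset T.Vertex)) (k : ∀ S ∈ s, T.Mono) : CGraph T :=
  ⟨c.graph.contract s k,
    (c.colours.filter (fun φ => ∀ S ∈ s, ¬ φ ⊆ S)).image (fun φ =>
      (φ \ s.biUnion id) ∪ (s.attach.filter (fun S => S.1 ⊆ φ)).image
        (fun S => ((c.graph.sub S.1).legs, k S.1 S.2)))⟩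

open scoped Classical in
/-- The unions of divergent subgraphs that do not overlap with a coloured subgraph. -/
def subdivergences (c : CGraph T) : Finset (Finset (Finset T.Vertex)) :=
  c.graph.subdivergences.filter (fun s => ∀ S ∈ s, ∀ φ ∈ c.colours, NonOverlapping S φ)

open scoped Classical in
/-- Gluing: in the graph `Γ`, every vertex whose set of half-edges is the set of legs of a member of
`m` is replaced by that member, legs being identified with the half-edges of the vertex of the
same name. Hence the names of the half-edges are the gluing data. -/
def glue (Γ : Graph T) (m : Finset (CGraph T)) : CGraph T where
  graph :=
    { verts := Γ.verts.filter (fun v => ∀ c ∈ m, v.1 ≠ c.graph.legs) ∪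
        m.biUnion (fun c => c.graph.verts)
      edges := Γ.edges ∪ m.biUnion (fun c => c.graph.edges) }
  colours := m.biUnion colours

open scoped Classical in
/-- Apply `Θ` to a coloured graph: colour the whole graph, unless `Θ` is trivial on its external
structures. -/
def colour (Θ : ExternalChange T) (c : CGraph T) : CGraph T :=
  if Θ.map c.graph.legs = LinearMap.id then c else ⟨c.graph, insert c.graph.verts c.colours⟩

end CGraph

/-- Polynomials in coloured graphs; the product is the disjoint union. -/
abbrev CAlg (T : QFT) : Type := MvPolynomial (CGraph T) ℂ

/-- Linear extension of the gluing of disjoint unions of coloured graphs into `Γ`. -/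
def glueLinear (Γ : Graph T) (x : CAlg T) : CAlg T :=
  ∑ m ∈ x.support, MvPolynomial.C (x.coeff m) * MvPolynomial.X (CGraph.glue Γ m.support)

/-- The cograph `Γ/γ` into which `γ` is glued back; as the new vertices are the places where the
components are inserted, it does not matter which of the matching kinds they are given. -/
def cograph (Γ : Graph T) (s : Finset (Finset T.Vertex)) (hs : s ∈ Γ.subdivergences) : Graph T :=
  Γ.contract s (fun _ hS => (Graph.monomials_nonempty hs hS).choose)

/-- `S_Θ(Γ) = -Θ[Γ + ∑_{γ ⊂ Γ} Γ/γ ⋆_G S_Θ(γ)]`, multiplicative on disjoint unions, as a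
combination of coloured graphs. -/
def twistedAntipode (Θ : ExternalChange T) (Γ : Graph T) : CAlg T :=
  - MvPolynomial.rename (CGraph.colour Θ)
    (MvPolynomial.X ⟨Γ, ∅⟩ + ∑ s : {s // s ∈ Γ.subdivergences},
      glueLinear (cograph Γ s.1 s.2)
        (∏ S : {S // S ∈ s.1}, twistedAntipode Θ (Γ.sub S.1)))
termination_by Γ.verts.card
decreasing_by exact Graph.card_sub_lt s.2 S.2

/-- `(S_Θ ⋆ id)(Γ) = S_Θ(Γ) + Γ + ∑_{γ ⊂ Γ} Γ/γ ⋆_G S_Θ(γ)`. -/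
def twistedStarId (Θ : ExternalChange T) (Γ : Graph T) : CAlg T :=
  twistedAntipode Θ Γ + (MvPolynomial.X ⟨Γ, ∅⟩ + ∑ s : {s // s ∈ Γ.subdivergences},
      glueLinear (cograph Γ s.1 s.2)
        (∏ S : {S // S ∈ s.1}, twistedAntipode Θ (Γ.sub S.1)))

/-! ### The Hopf algebra of specified graphs -/

/-- A coloured graph with its set of legs, ready to be specified. -/
structure SpecIndex (T : QFT) where
  L : Finset T.HalfEdge
  c : CGraph T
  good : c.Good
  legs_eq : c.graph.legs = L

/-- The linear span of the connected specified graphs `(Γ,σ)`, linear in `σ`. -/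
abbrev SpecSpace (T : QFT) : Type := DirectSum (SpecIndex T) (fun i => ExtStr T.D i.L)

/-- The commutative algebra freely generated by connected specified graphs. -/
abbrev SpecAlg (T : QFT) : Type := SymmetricAlgebra ℂ (SpecSpace T)

open scoped Classical in
/-- The generator `(c,σ)`, for an external structure `σ` on the set of legs `L` of `c`. -/
def gen (L : Finset T.HalfEdge) (c : CGraph T) : ExtStr T.D L →ₗ[ℂ] SpecAlg T :=
  if h : c.Good ∧ c.graph.legs = L then
    (SymmetricAlgebra.ι ℂ (SpecSpace T)).comp
      (DirectSum.lof ℂ (SpecIndex T) (fun i => ExtStr T.D i.L) ⟨L, c, h.1, h.2⟩)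
  else 0

open scoped Classical in
/-- Read coloured graphs with legs `L` as specified graphs, given the external structure `σ`:
a colour on the whole graph changes `σ` to `Θ(σ)`. -/
def specify (Θ : ExternalChange T) (L : Finset T.HalfEdge) (σ : ExtStr T.D L) :
    CAlg T →ₐ[ℂ] SpecAlg T :=
  MvPolynomial.aeval (fun c =>
    gen L c.inner (if c.graph.verts ∈ c.colours then Θ.map L σ else σ))

open scoped Classical in
/-- A component `S` of a subgraph of `c`, as a specified graph: it carries the external structure
of the monomial `P`, changed by `Θ` if `S` is coloured. -/
def component (Θ : ExternalChange T) (c : CGraph T) (S : Finset T.Vertex) (P : T.Mono) :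
    SpecAlg T :=
  gen (c.graph.sub S).legs (c.sub S)
    (if S ∈ c.colours then Θ.map _ (T.extStr P _) else T.extStr P _)

open scoped Classical in
/-- The sum `∑ γ ⊗ Γ/γ` over unions of proper divergent subgraphs and over the external structures
of the monomials that match their residues. -/
def reducedCoproductGen (Θ : ExternalChange T) (i : SpecIndex T) :
    ExtStr T.D i.L →ₗ[ℂ] SpecAlg T ⊗[ℂ] SpecAlg T :=
  ∑ s ∈ i.c.subdivergences, ∑ k ∈ s.pi (fun S => (i.c.graph.sub S).monomials),
    (TensorProduct.mk ℂ (SpecAlg T) (SpecAlg T)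
      (∏ S ∈ s.attach, component Θ i.c S.1 (k S.1 S.2))).comp (gen i.L (i.c.contract s k))

/-- `Δ(Γ,σ) = (Γ,σ) ⊗ 1 + 1 ⊗ (Γ,σ) + ∑ γ ⊗ (Γ/γ,σ)`. -/
def coproductGen (Θ : ExternalChange T) (i : SpecIndex T) :
    ExtStr T.D i.L →ₗ[ℂ] SpecAlg T ⊗[ℂ] SpecAlg T :=
  ((TensorProduct.mk ℂ (SpecAlg T) (SpecAlg T)).flip 1).comp (gen i.L i.c) +
    (TensorProduct.mk ℂ (SpecAlg T) (SpecAlg T) 1).comp (gen i.L i.c) +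
    reducedCoproductGen Θ i

open scoped Classical in
/-- The coproduct, extended to an algebra homomorphism. -/
def coproduct (Θ : ExternalChange T) : SpecAlg T →ₐ[ℂ] SpecAlg T ⊗[ℂ] SpecAlg T :=
  SymmetricAlgebra.lift (DirectSum.toModule ℂ (SpecIndex T) (SpecAlg T ⊗[ℂ] SpecAlg T)
    (coproductGen Θ))

/-! ### The bidegree -/

/-- A specified graph `(Γ,σ)` is superficially convergent if `σ` annihilates the polynomials in the
external momenta of degree at most the degree of divergence of `Γ` (in particular, if that
degree is negative). -/
def SuperficiallyConvergent (Γ : Graph T) {L : Finset T.HalfEdge} (σ : ExtStr T.D L) : Prop :=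
  ∀ f : MomentumFn T.D L, IsPolyOfDegreeLE f Γ.degree → σ.1 f = 0

/-- The ideal generated by the superficially convergent specified graphs. -/
def convergentIdeal (T : QFT) : Ideal (SpecAlg T) :=
  Ideal.span {x | ∃ (i : SpecIndex T) (σ : ExtStr T.D i.L),
    SuperficiallyConvergent i.c.graph σ ∧ x = gen i.L i.c σ}

/-- The algebra of superficially divergent specified graphs. -/
abbrev DivAlg (T : QFT) : Type := SpecAlg T ⧸ convergentIdeal T

/-- `X ↦ Δ(X) - 1 ⊗ X`, with the left factors in the algebra of superficially divergent graphs: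
it detects the renormalization parts of `X`, including `X` itself. -/
def divergentParts (Θ : ExternalChange T) : SpecAlg T →ₗ[ℂ] DivAlg T ⊗[ℂ] SpecAlg T :=
  ((Algebra.TensorProduct.map (Ideal.Quotient.mkₐ ℂ (convergentIdeal T))
      (AlgHom.id ℂ (SpecAlg T))).comp (coproduct Θ)).toLinearMap -
    TensorProduct.mk ℂ (DivAlg T) (SpecAlg T) 1

/-- The elements `X` such that `divergentParts Θ X` lies in `DivAlg T ⊗ W`. -/
def bidegreeStep (Θ : ExternalChange T) (W : Submodule ℂ (SpecAlg T)) :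
    Submodule ℂ (SpecAlg T) :=
  (LinearMap.range (LinearMap.lTensor (DivAlg T) W.subtype)).comap (divergentParts Θ)

/-- The elements of bidegree at most `n`: those annihilated by `n + 1` successive applications of
`divergentParts` (each one acting on the last tensor factor). -/
def bidegreeLE (Θ : ExternalChange T) (n : ℕ) : Submodule ℂ (SpecAlg T) :=
  (bidegreeStep Θ)^[n] (LinearMap.ker (divergentParts Θ))

/-- The bidegree. -/
def bid (Θ : ExternalChange T) (x : SpecAlg T) : ℕ∞ :=
  ⨅ (n : ℕ) (_ : x ∈ bidegreeLE Θ n), (n : ℕ∞)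

end FeynmanGraphs

end

/-! The recursion has a closed solution in terms of forests. Gluing the coloured components of `γ`
back into `Γ/γ` returns `Γ` itself, with colours recorded on sets of vertices. So everything happens
inside a polynomial ring with one variable `X S` for each set of vertices `S`, where gluing is
multiplication (`glueLinear_cograph`) and applying `Θ` is multiplication by the variable of the
whole graph, or by `1` where `Θ` is trivial (`rename_colour_withColours`).

If `Γ` has no self-energy part, each part `S` contributes `-X S` times the forest sum of the parts
inside `S`. Grouping forests by their maximal elements (`indepSum_nonOverlapping_eq`) then shows
that the bracket in the recursion is the sum of `∏ (-X S)` over all forests of parts. If there is a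
self-energy part, take a smallest one, `A`. Parts strictly above `A` contribute zero by induction,
`A` overlaps nothing, and as `Θ` does nothing on two legs, the weight of `A` is minus the sum over
the families strictly inside `A`. Hence the bracket vanishes (`indepSum_disjoint_eq_zero`), and with
it both `S_Θ(Γ)` and `(S_Θ ⋆ id)(Γ)`.

Without self-energy parts, let `X(σ)` be the signed forest sum specified by `σ`. Then `S_Θ(Γ,σ) =
-X(Θσ)` and `(S_Θ ⋆ id)(Γ,σ) = X(σ - Θσ)`. In `δ(X(σ))`, fix a subdivergence `γ` and one component
`S` of it, and pair the forests `F` and `F ∪ {S}`. Their signs are opposite, the cographs agree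
since the colour of `S` is shrunk away, and the left factors differ by `Θ` on the structure of `S`,
which is invisible modulo convergent graphs. So `δ(X(σ)) = π(X(σ)) ⊗ 1` (`forest_sum_bidegree`): the
bidegree is at most one, and it is zero exactly when `X(σ)` is in the convergent ideal. That holds
for `σ - Θσ`. It fails for `Θσ` when `σ` is divergent, because evaluation on a polynomial that
detects `σ` is a character that kills the ideal but not `X(Θσ)`. -/

noncomputable section

namespace FeynmanGraphs

/-! ### Sums over independent sets -/

section IndepSum

variable {β R : Type*} [CommRing R]

open scoped Classical in
/-- The subsets of `P` with pairwise `r`-related elements. -/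
def indepSets (r : β → β → Prop) (P : Finset β) : Finset (Finset β) :=
  P.powerset.filter (fun s : Finset β => (s : Set β).Pairwise r)

theorem mem_indepSets {r : β → β → Prop} {P s : Finset β} :
    s ∈ indepSets r P ↔ s ⊆ P ∧ (s : Set β).Pairwise r := by
  classical
  simp [indepSets]

theorem empty_mem_indepSets (r : β → β → Prop) (P : Finset β) : ∅ ∈ indepSets r P := by
  simp [mem_indepSets]

/-- The sum, over the subsets of `P` with pairwise `r`-related elements, of the product of the
weights of the elements. -/
def indepSum (r : β → β → Prop) (P : Finset β) (z : β → R) : R :=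
  ∑ s ∈ indepSets r P, ∏ S ∈ s, z S

theorem indepSum_empty (r : β → β → Prop) (z : β → R) : indepSum r ∅ z = 1 := by
  classical
  simp [indepSum, indepSets, Finset.sum_filter]

theorem indepSum_congr {r : β → β → Prop} {P : Finset β} {z z' : β → R}
    (h : ∀ S ∈ P, z S = z' S) : indepSum r P z = indepSum r P z' := by
  refine Finset.sum_congr rfl fun s hs => Finset.prod_congr rfl fun S hS => h S ?_
  exact (mem_indepSets.1 hs).1 hS

/-- Split by whether `M` is chosen; once it is, the other elements must be related to `M`. This
recursion drives the inductions below. -/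
theorem indepSum_insert [DecidableEq β] {r : β → β → Prop} [Std.Symm r] [DecidableRel r] {P : Finset β} {M : β}
    (hM : M ∉ P) (z : β → R) :
    indepSum r (insert M P) z = indepSum r P z + z M * indepSum r (P.filter (r M)) z := by
  classical
  unfold indepSum indepSets
  rw [Finset.sum_filter, Finset.sum_powerset_insert hM, Finset.sum_filter, Finset.mul_sum]
  congr 1
  have e : P.powerset.filter (fun t : Finset β => ((insert M t : Finset β) : Set β).Pairwise r) =
      (P.filter (r M)).powerset.filter (fun t : Finset β => (t : Set β).Pairwise r) := by
    ext s
    simp only [Finset.mem_filter, Finset.mem_powerset, Finset.coe_insert]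
    constructor
    · rintro ⟨hs, h⟩
      have hMs : M ∉ (s : Set β) := fun h' => hM (hs h')
      rw [Set.pairwise_insert_of_symm_of_notMem hMs] at h
      exact ⟨fun x hx => Finset.mem_filter.2 ⟨hs hx, h.2 x hx⟩, h.1⟩
    · rintro ⟨hs, h⟩
      have hMs : M ∉ (s : Set β) := fun h' => hM (Finset.mem_filter.1 (hs h')).1
      rw [Set.pairwise_insert_of_symm_of_notMem hMs]
      exact ⟨fun x hx => (Finset.mem_filter.1 (hs hx)).1, h,
        fun x hx => (Finset.mem_filter.1 (hs hx)).2⟩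
  refine Eq.trans ?_ (Finset.sum_congr (e.trans (by ext; simp)) fun _ _ => rfl)
  rw [Finset.sum_filter]
  refine Finset.sum_congr rfl fun s hs => ?_
  simp only [Finset.prod_insert fun h' => hM (Finset.mem_powerset.1 hs h')]

/-- When every element of `A` is related to every element of `B`, choices in `A` and in `B` are
independent of each other. In the induction, choosing `M ∈ A` removes nothing from `B`. -/
theorem indepSum_union [DecidableEq β] {r : β → β → Prop} [Std.Symm r] (z : β → R) (A B : Finset β)
    (hAB : Disjoint A B) (h : ∀ a ∈ A, ∀ b ∈ B, r a b) :
    indepSum r (A ∪ B) z = indepSum r A z * indepSum r B z := by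
  classical
  induction A using Finset.strongInduction with
  | H A ih =>
    rcases A.eq_empty_or_nonempty with rfl | ⟨M, hMA⟩
    · simp [indepSum_empty]
    obtain ⟨A', hMA', rfl⟩ : ∃ A', M ∉ A' ∧ insert M A' = A :=
      ⟨A.erase M, by simp, Finset.insert_erase hMA⟩
    have hMB : M ∉ B := Finset.disjoint_left.1 hAB hMA
    have hlt : A' ⊂ insert M A' := Finset.ssubset_insert hMA'
    have hf : B.filter (r M) = B := Finset.filter_true_of_mem (h M hMA)
    have hd' : Disjoint A' B := hAB.mono_left hlt.subset
    rw [Finset.insert_union, indepSum_insert (by simp [hMA', hMB]), indepSum_insert hMA',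
      Finset.filter_union, hf, ih A' hlt hd' fun a ha => h a (hlt.subset ha),
      ih (A'.filter (r M)) ((Finset.filter_subset _ _).trans_ssubset hlt)
        (hd'.mono_left (Finset.filter_subset _ _))
        fun a ha => h a (hlt.subset (Finset.filter_subset _ _ ha))]
    ring

theorem indepSum_filter_of_zero {r : β → β → Prop} {P : Finset β} {z : β → R} (p : β → Prop) [DecidablePred p]
    (h : ∀ S ∈ P, ¬ p S → z S = 0) : indepSum r (P.filter p) z = indepSum r P z := by
  refine Finset.sum_subset (fun s hs => ?_) fun s hs hs' => ?_
  · rw [mem_indepSets] at hs ⊢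
    exact ⟨hs.1.trans (Finset.filter_subset _ _), hs.2⟩
  rw [mem_indepSets] at hs hs'
  obtain ⟨S, hS, hpS⟩ : ∃ S ∈ s, ¬ p S := by
    by_contra! hc
    exact hs' ⟨fun S hS => Finset.mem_filter.2 ⟨hs.1 hS, hc S hS⟩, hs.2⟩
  exact Finset.prod_eq_zero hS (h S (hs.1 hS) hpS)

end IndepSum

/-! ### Forests of sets of vertices -/

section Forests

variable {T : QFT} {R : Type*} [CommRing R]

theorem NonOverlapping.symm {S S' : Finset T.Vertex} (h : NonOverlapping S S') :
    NonOverlapping S' S := by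
  rcases h with h | h | h
  exacts [Or.inr (Or.inl h), Or.inl h, Or.inr (Or.inr h.symm)]

theorem nonOverlapping_refl (S : Finset T.Vertex) : NonOverlapping S S :=
  Or.inl (Finset.Subset.refl S)

instance : Std.Symm (NonOverlapping : Finset T.Vertex → Finset T.Vertex → Prop) :=
  ⟨fun _ _ h => h.symm⟩

open scoped Classical in
/-- The sum over all forests grouped by their maximal elements. -/
theorem indepSum_nonOverlapping_eq (P : Finset (Finset T.Vertex)) (hP : ∀ S ∈ P, S.Nonempty)
    (y : Finset T.Vertex → R) :
    indepSum NonOverlapping P y =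
      indepSum Disjoint P (fun S => y S * indepSum NonOverlapping (P.filter (· ⊂ S)) y) := by
  induction P using Finset.strongInduction with
  | H P ih =>
    rcases P.eq_empty_or_nonempty with rfl | hne
    · simp [indepSum_empty]
    -- An element of maximal cardinality lies inside no other one. So it plays no role below the
    -- remaining elements, and what is compatible with it lies strictly inside it or is disjoint
    -- from it.
    obtain ⟨M, hMP, hmax⟩ := P.exists_max_image Finset.card hne
    obtain ⟨Q, hMQ, rfl⟩ : ∃ Q, M ∉ Q ∧ insert M Q = P :=
      ⟨P.erase M, by simp, Finset.insert_erase hMP⟩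
    have hlt : Q ⊂ insert M Q := Finset.ssubset_insert hMQ
    have hnot : ∀ S ∈ Q, ¬ M ⊆ S := fun S hS h => by
      rw [Finset.eq_of_subset_of_card_le h (hmax S (hlt.subset hS))] at hMQ
      exact hMQ hS
    have hbelow : ∀ S ∈ insert M Q, (insert M Q).filter (· ⊂ S) = Q.filter (· ⊂ S) := by
      intro S hS
      rw [Finset.filter_insert, if_neg]
      intro h
      exact absurd (Finset.card_lt_card h) (not_lt.2 (hmax S hS))
    have hfil : Q.filter (NonOverlapping M) = Q.filter (· ⊂ M) ∪ Q.filter (Disjoint M) := by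
      ext S
      simp only [Finset.mem_filter, Finset.mem_union, NonOverlapping, ← and_or_left]
      refine and_congr_right fun hS => ?_
      constructor
      · rintro (h | h | h)
        · exact absurd h (hnot S hS)
        · exact Or.inl (h.ssubset_of_ne fun h' => hMQ (h' ▸ hS))
        · exact Or.inr h
      · rintro (h | h)
        exacts [Or.inr (Or.inl h.subset), Or.inr (Or.inr h)]
    have hdisj : Disjoint (Q.filter (· ⊂ M)) (Q.filter (Disjoint M)) := by
      refine Finset.disjoint_left.2 fun S h h' => ?_
      rw [Finset.mem_filter] at h h'
      obtain ⟨v, hv⟩ := hP S (hlt.subset h.1)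
      exact Finset.disjoint_left.1 h'.2 (h.2.subset hv) hv
    rw [indepSum_insert hMQ, indepSum_insert hMQ,
      hfil, indepSum_union _ _ _ hdisj, hbelow M hMP,
      ih Q hlt fun S hS => hP S (hlt.subset hS),
      ih (Q.filter (Disjoint M)) ((Finset.filter_subset _ _).trans_ssubset hlt)
        fun S hS => hP S (hlt.subset (Finset.filter_subset _ _ hS)), ← mul_assoc]
    · congr 1
      · exact indepSum_congr fun S hS => by rw [hbelow S (hlt.subset hS)]
      · congr 1
        refine indepSum_congr fun S hS => ?_
        rw [Finset.mem_filter] at hS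
        rw [hbelow S (hlt.subset hS.1), Finset.filter_filter]
        congr 2
        refine Finset.filter_congr fun S' _ => ?_
        exact ⟨fun h => h.2, fun h => ⟨hS.2.mono_right h.subset, h⟩⟩
    · intro a ha b hb
      rw [Finset.mem_filter] at ha hb
      exact Or.inr (Or.inr (hb.2.mono_left ha.2.subset))

open scoped Classical in
/-- If `A` overlaps no member of `P`, and the weights vanish above `A`, then the weight of `A`
can cancel the families inside `A`. -/
theorem indepSum_disjoint_eq_zero {P : Finset (Finset T.Vertex)} (hP : ∀ S ∈ P, S.Nonempty)
    {A : Finset T.Vertex} (hA : A ∈ P) (hno : ∀ S ∈ P, NonOverlapping A S)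
    {z : Finset T.Vertex → R} (hz : ∀ S ∈ P, A ⊂ S → z S = 0)
    (hzA : z A = - indepSum Disjoint (P.filter (· ⊂ A)) z) : indepSum Disjoint P z = 0 := by
  have hAne := hP A hA
  have hAA : ¬ Disjoint A A := fun h => hAne.ne_empty (by simpa using h)
  have hdisj : Disjoint (P.filter (· ⊂ A)) (P.filter (Disjoint A)) := by
    refine Finset.disjoint_left.2 fun S h h' => ?_
    rw [Finset.mem_filter] at h h'
    obtain ⟨v, hv⟩ := hP S h.1
    exact Finset.disjoint_left.1 h'.2 (h.2.subset hv) hv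
  have hfil : P.filter (fun S => ¬ A ⊂ S) =
      insert A (P.filter (· ⊂ A) ∪ P.filter (Disjoint A)) := by
    ext S
    simp only [Finset.mem_filter, Finset.mem_union, Finset.mem_insert]
    constructor
    · rintro ⟨hS, h⟩
      by_cases hSA : S = A
      · exact Or.inl hSA
      rcases hno S hS with h' | h' | h'
      · exact absurd (h'.ssubset_of_ne (Ne.symm hSA)) h
      · exact Or.inr (Or.inl ⟨hS, h'.ssubset_of_ne hSA⟩)
      · exact Or.inr (Or.inr ⟨hS, h'⟩)
    · rintro (rfl | h | h)
      · exact ⟨hA, fun h => h.ne rfl⟩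
      · exact ⟨h.1, fun h' => (h.2.trans h').ne rfl⟩
      · exact ⟨h.1, fun h' => hAA (h.2.mono_right h'.subset)⟩
  have hAnot : A ∉ P.filter (· ⊂ A) ∪ P.filter (Disjoint A) := by
    simp [hAne.ne_empty]
  have hfil' : (P.filter (· ⊂ A) ∪ P.filter (Disjoint A)).filter (Disjoint A) =
      P.filter (Disjoint A) := by
    ext S
    simp only [Finset.mem_filter, Finset.mem_union]
    constructor
    · rintro ⟨h | h, h'⟩
      exacts [⟨h.1, h'⟩, h]
    · intro h
      exact ⟨Or.inr h, h.2⟩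
  -- What is left is `A`, the sets inside `A` and the sets disjoint from `A`. Families without `A`
  -- give (inside) times (disjoint); families with `A` give `z A` times (disjoint), which is the
  -- negative.
  rw [← indepSum_filter_of_zero (fun S => ¬ A ⊂ S) fun S hS h => hz S hS (not_not.1 h), hfil,
    indepSum_insert hAnot, hfil',
    indepSum_union _ _ _ hdisj, hzA]
  · ring
  · intro a ha b hb
    rw [Finset.mem_filter] at ha hb
    exact hb.2.mono_left ha.2.subset

end Forests

variable {T : QFT}

/-! ### Parts of subgraphs -/

namespace Graph

open scoped Classical in
theorem mem_parts {Γ : Graph T} {S : Finset T.Vertex} :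
    S ∈ Γ.parts ↔ S ⊆ Γ.verts ∧ S ≠ Γ.verts ∧ (Γ.sub S).Is1PI ∧ 0 ≤ (Γ.sub S).degree ∧
      (Γ.sub S).monomials.Nonempty := by
  simp [parts]

theorem mem_subdivergences {Γ : Graph T} {s : Finset (Finset T.Vertex)} :
    s ∈ Γ.subdivergences ↔
      s ⊆ Γ.parts ∧ s.Nonempty ∧ ∀ S ∈ s, ∀ S' ∈ s, S ≠ S' → Disjoint S S' := by
  classical
  simp [subdivergences]

theorem nonempty_of_mem_parts {Γ : Graph T} {S : Finset T.Vertex} (hS : S ∈ Γ.parts) :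
    S.Nonempty :=
  (mem_parts.1 hS).2.2.1.npi.1

theorem ssubset_of_mem_parts {Γ : Graph T} {S : Finset T.Vertex} (hS : S ∈ Γ.parts) :
    S ⊂ Γ.verts :=
  (mem_parts.1 hS).1.ssubset_of_ne (mem_parts.1 hS).2.1

theorem sub_sub {Γ : Graph T} {S S' : Finset T.Vertex} (h : S' ⊆ S) :
    (Γ.sub S).sub S' = Γ.sub S' := by
  classical
  refine Graph.ext rfl ?_
  ext e
  simp only [sub, Finset.mem_filter, and_assoc]
  exact and_congr_right fun _ =>
    ⟨fun h' => h'.2, fun h' => ⟨h'.trans (Finset.biUnion_subset_biUnion_of_subset_left _ h), h'⟩⟩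

-- Being a part of `S` depends on `Γ` only through the edges among the vertices concerned. This lets
-- the recursion on subgraphs run entirely inside the fixed set of parts of `Γ`.
open scoped Classical in
theorem parts_sub {Γ : Graph T} {S : Finset T.Vertex} (hS : S ⊆ Γ.verts) :
    (Γ.sub S).parts = Γ.parts.filter (· ⊂ S) := by
  ext S'
  simp only [Finset.mem_filter, mem_parts]
  constructor
  · rintro ⟨h1, h2, h3⟩
    have h1 : S' ⊆ S := h1
    have h2 : S' ≠ S := h2
    rw [sub_sub h1] at h3
    refine ⟨⟨h1.trans hS, fun h => h2 (h1.antisymm (h ▸ hS)), h3⟩, h1.ssubset_of_ne h2⟩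
  · rintro ⟨⟨h1, h2, h3⟩, h4⟩
    rw [sub_sub h4.subset]
    exact ⟨h4.subset, h4.ne, h3⟩

theorem exists_mem_of_mem_legs {Γ : Graph T} {h : T.HalfEdge} (hh : h ∈ Γ.legs) :
    ∃ v ∈ Γ.verts, h ∈ v.1 := by
  classical
  simp only [legs, halves, Finset.mem_sdiff, Finset.mem_biUnion] at hh
  exact hh.1

end Graph

/-! ### Polynomials in colours -/

/-- A monomial in colours (sets of vertices) is read as the graph `Γ` with these colours. -/
def withColours (Γ : Graph T) : MvPolynomial (Finset T.Vertex) ℂ →ₗ[ℂ] CAlg T :=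
  (MvPolynomial.basisMonomials (Finset T.Vertex) ℂ).constr ℂ
    (fun m => MvPolynomial.X ⟨Γ, m.support⟩)

theorem withColours_monomial (Γ : Graph T) (m : Finset T.Vertex →₀ ℕ) :
    withColours Γ (MvPolynomial.monomial m 1) = MvPolynomial.X ⟨Γ, m.support⟩ := by
  have := (MvPolynomial.basisMonomials (Finset T.Vertex) ℂ).constr_basis ℂ
    (fun m => (MvPolynomial.X ⟨Γ, m.support⟩ : CAlg T)) m
  rwa [MvPolynomial.coe_basisMonomials] at this

theorem withColours_one (Γ : Graph T) : withColours Γ 1 = MvPolynomial.X ⟨Γ, ∅⟩ := by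
  have := withColours_monomial Γ 0
  simpa using this

/-! ### Gluing as multiplication of colour polynomials -/

/-- Gluing as a linear map. -/
def glueHom (Γ : Graph T) : CAlg T →ₗ[ℂ] CAlg T :=
  (MvPolynomial.basisMonomials (CGraph T) ℂ).constr ℂ
    (fun m => MvPolynomial.X (CGraph.glue Γ m.support))

theorem glueHom_monomial (Γ : Graph T) (m : CGraph T →₀ ℕ) :
    glueHom Γ (MvPolynomial.monomial m 1) = MvPolynomial.X (CGraph.glue Γ m.support) := by
  have := (MvPolynomial.basisMonomials (CGraph T) ℂ).constr_basis ℂ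
    (fun m => (MvPolynomial.X (CGraph.glue Γ m.support) : CAlg T)) m
  rwa [MvPolynomial.coe_basisMonomials] at this

theorem glueLinear_eq (Γ : Graph T) (x : CAlg T) : glueLinear Γ x = glueHom Γ x := by
  conv_rhs => rw [x.as_sum, map_sum]
  refine Finset.sum_congr rfl fun m _ => ?_
  have h : MvPolynomial.monomial m (x.coeff m) =
      x.coeff m • MvPolynomial.monomial m (1 : ℂ) := by
    rw [MvPolynomial.smul_monomial, smul_eq_mul, mul_one]
  rw [h, map_smul, glueHom_monomial, MvPolynomial.smul_eq_C_mul]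

/-- Exponents in `ℕ` cannot cancel. -/
theorem support_sum_nat {ι κ : Type*} [DecidableEq κ] (s : Finset ι) (f : ι → κ →₀ ℕ) :
    (∑ i ∈ s, f i).support = s.biUnion (fun i => (f i).support) := by
  ext a
  simp [Finsupp.finsetSum_apply, Finset.sum_eq_zero_iff]

theorem prod_monomial_one {ι κ : Type*} (s : Finset ι) (f : ι → κ →₀ ℕ) :
    ∏ i ∈ s, MvPolynomial.monomial (f i) (1 : ℂ) = MvPolynomial.monomial (∑ i ∈ s, f i) 1 := by
  classical
  induction s using Finset.induction_on with
  | empty => simp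
  | insert a s ha ih => simp [Finset.prod_insert ha, Finset.sum_insert ha, ih,
      MvPolynomial.monomial_mul]

-- Contracting and gluing back are inverse to each other because half-edges keep their names. The
-- point to check is that a vertex outside the components is not mistaken for a shrunken one.
open scoped Classical in
theorem glue_cograph {Γ : Graph T} (hΓ : Γ.IsFeynman) {s : Finset (Finset T.Vertex)}
    (hs : s ∈ Γ.subdivergences) (C : {S // S ∈ s} → Finset (Finset T.Vertex)) :
    CGraph.glue (cograph Γ s hs) (Finset.univ.image fun S => ⟨Γ.sub S.1, C S⟩) =
      ⟨Γ, Finset.univ.biUnion C⟩ := by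
  have hparts := (Graph.mem_subdivergences.1 hs).1
  refine CGraph.ext (Graph.ext ?_ ?_) ?_
  · ext v
    simp only [CGraph.glue, cograph, Graph.contract, Finset.mem_union, Finset.mem_filter,
      Finset.mem_sdiff, Finset.mem_biUnion, Finset.mem_image, Finset.mem_attach, true_and,
      Finset.mem_univ, id, Subtype.exists, forall_exists_index]
    constructor
    · rintro (⟨⟨h, -⟩ | ⟨S, hS, rfl⟩, h'⟩ | ⟨c, ⟨S, hS, rfl⟩, hv⟩)
      · exact h
      · exact absurd rfl (h' _ S hS rfl)
      · exact (Graph.mem_parts.1 (hparts hS)).1 hv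
    · intro hv
      by_cases h : ∃ S ∈ s, v ∈ S
      · obtain ⟨S, hS, hvS⟩ := h
        exact Or.inr ⟨_, ⟨S, hS, rfl⟩, hvS⟩
      · refine Or.inl ⟨Or.inl ⟨hv, h⟩, ?_⟩
        rintro _ S hS rfl heq
        have h1 := Graph.mem_parts.1 (hparts hS)
        -- A component has at least two legs. If these were the half-edges of `v`, one of them would
        -- belong both to `v` and to a different vertex inside the component.
        obtain ⟨x, hx⟩ : (Γ.sub S).legs.Nonempty := by
          rw [← Finset.card_pos]
          exact lt_of_lt_of_le zero_lt_two h1.2.2.1.two_le_legs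
        obtain ⟨w, hw, hxw⟩ := Graph.exists_mem_of_mem_legs hx
        have hvw : v ≠ w := fun h' => h ⟨S, hS, h' ▸ hw⟩
        exact Finset.disjoint_left.1 (hΓ.verts_disjoint v hv w (h1.1 hw) hvw)
          (heq ▸ hx) hxw
  · ext e
    simp only [CGraph.glue, cograph, Graph.contract, Finset.mem_union, Finset.mem_sdiff,
      Finset.mem_biUnion, Finset.mem_image, Finset.mem_univ, true_and, Subtype.exists]
    constructor
    · rintro (⟨h, -⟩ | ⟨c, ⟨S, hS, rfl⟩, he⟩)
      · exact h
      · exact Finset.filter_subset _ _ he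
    · intro he
      by_cases h : ∃ S ∈ s, e ∈ (Γ.sub S).edges
      · obtain ⟨S, hS, h⟩ := h
        exact Or.inr ⟨_, ⟨S, hS, rfl⟩, h⟩
      · exact Or.inl ⟨he, h⟩
  · simp [CGraph.glue, Finset.image_biUnion]

theorem glueLinear_cograph {Γ : Graph T} (hΓ : Γ.IsFeynman) {s : Finset (Finset T.Vertex)}
    (hs : s ∈ Γ.subdivergences) (z : Finset T.Vertex → MvPolynomial (Finset T.Vertex) ℂ) :
    glueLinear (cograph Γ s hs) (∏ S : {S // S ∈ s}, withColours (Γ.sub S.1) (z S.1)) =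
      withColours Γ (∏ S ∈ s, z S) := by
  classical
  rw [glueLinear_eq, ← Finset.prod_coe_sort s z]
  -- Both sides are multilinear in the factors, so monomials suffice, and there the claim is
  -- `glue_cograph`. Only supports of exponents matter, so repeated factors do no harm.
  have key : (glueHom (cograph Γ s hs)).compMultilinearMap
      ((MultilinearMap.mkPiAlgebra ℂ {S // S ∈ s} (CAlg T)).compLinearMap
        fun S => withColours (Γ.sub S.1)) =
      (withColours Γ).compMultilinearMap
        (MultilinearMap.mkPiAlgebra ℂ {S // S ∈ s} (MvPolynomial (Finset T.Vertex) ℂ)) := by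
    refine Module.Basis.ext_multilinear
      (fun _ => MvPolynomial.basisMonomials (Finset T.Vertex) ℂ) fun m => ?_
    simp only [LinearMap.compMultilinearMap_apply, MultilinearMap.compLinearMap_apply,
      MultilinearMap.mkPiAlgebra_apply, MvPolynomial.coe_basisMonomials, withColours_monomial]
    rw [prod_monomial_one, withColours_monomial, support_sum_nat, ← glue_cograph hΓ hs]
    simp only [MvPolynomial.X]
    rw [prod_monomial_one, glueHom_monomial, support_sum_nat]
    congr 2
    ext c
    simp [eq_comm]
  exact congrArg (fun f => f fun S => z S.1) key

/-! ### The recursion in colour polynomials -/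

/-- `Γ + ∑_{γ ⊂ Γ} Γ/γ ⋆_G S_Θ(γ)`. -/
def preparation (Θ : ExternalChange T) (Γ : Graph T) : CAlg T :=
  MvPolynomial.X ⟨Γ, ∅⟩ + ∑ s : {s // s ∈ Γ.subdivergences},
    glueLinear (cograph Γ s.1 s.2) (∏ S : {S // S ∈ s.1}, twistedAntipode Θ (Γ.sub S.1))

theorem twistedAntipode_eq_neg (Θ : ExternalChange T) (Γ : Graph T) :
    twistedAntipode Θ Γ = - MvPolynomial.rename (CGraph.colour Θ) (preparation Θ Γ) := by
  rw [twistedAntipode, preparation]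

theorem twistedStarId_eq_add (Θ : ExternalChange T) (Γ : Graph T) :
    twistedStarId Θ Γ = twistedAntipode Θ Γ + preparation Θ Γ := rfl

/-- The bare term `Γ` is the contribution of the empty family, so the whole bracket becomes one sum
over families of disjoint parts. -/
theorem preparation_eq {Θ : ExternalChange T} {Γ : Graph T} (hΓ : Γ.IsFeynman)
    {z : Finset T.Vertex → MvPolynomial (Finset T.Vertex) ℂ}
    (hz : ∀ S ∈ Γ.parts, twistedAntipode Θ (Γ.sub S) = withColours (Γ.sub S) (z S)) :
    preparation Θ Γ = withColours Γ (indepSum Disjoint Γ.parts z) := by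
  classical
  have h : ∀ s : {s // s ∈ Γ.subdivergences},
      glueLinear (cograph Γ s.1 s.2) (∏ S : {S // S ∈ s.1}, twistedAntipode Θ (Γ.sub S.1)) =
        withColours Γ (∏ S ∈ s.1, z S) := by
    intro s
    rw [← glueLinear_cograph hΓ s.2]
    congr 1
    exact Finset.prod_congr rfl fun S _ =>
      hz S.1 ((Graph.mem_subdivergences.1 s.2).1 S.2)
  have hins : indepSets Disjoint Γ.parts = insert ∅ Γ.subdivergences := by
    ext s
    rw [mem_indepSets, Finset.mem_insert, Graph.mem_subdivergences]
    rcases s.eq_empty_or_nonempty with rfl | hne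
    · simp
    · simp only [hne, hne.ne_empty, true_and, false_or]
      rfl
  have hnot : ∅ ∉ Γ.subdivergences := fun h' => by
    simpa using (Graph.mem_subdivergences.1 h').2.1
  unfold preparation
  rw [Finset.sum_congr rfl fun s _ => h s,
    Finset.sum_coe_sort Γ.subdivergences (fun s => withColours Γ (∏ S ∈ s, z S)), ← map_sum,
    ← withColours_one, ← map_add]
  rw [indepSum, hins, Finset.sum_insert hnot, Finset.prod_empty]

open scoped Classical in
/-- The effect of `Θ` on the polynomials in colours. -/
def wholeColour (Θ : ExternalChange T) (Γ : Graph T) : MvPolynomial (Finset T.Vertex) ℂ :=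
  if Θ.map Γ.legs = LinearMap.id then 1 else MvPolynomial.X Γ.verts

/-- Inserting a set into the support of an exponent is multiplication by its variable, whether or
not it already occurs. -/
theorem rename_colour_withColours (Θ : ExternalChange T) (Γ : Graph T)
    (p : MvPolynomial (Finset T.Vertex) ℂ) :
    MvPolynomial.rename (CGraph.colour Θ) (withColours Γ p) =
      withColours Γ (wholeColour Θ Γ * p) := by
  classical
  have key : (MvPolynomial.rename (R := ℂ) (CGraph.colour Θ)).toLinearMap ∘ₗ withColours Γ =
      withColours Γ ∘ₗ LinearMap.mulLeft ℂ (wholeColour Θ Γ) := by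
    refine (MvPolynomial.basisMonomials (Finset T.Vertex) ℂ).ext fun m => ?_
    simp only [MvPolynomial.coe_basisMonomials, LinearMap.comp_apply, withColours_monomial,
      LinearMap.mulLeft_apply, AlgHom.toLinearMap_apply, MvPolynomial.rename_X]
    unfold wholeColour CGraph.colour
    split_ifs with h
    · rw [one_mul, withColours_monomial]
    · have h' : MvPolynomial.X Γ.verts * MvPolynomial.monomial m (1 : ℂ) =
          MvPolynomial.monomial (Finsupp.single Γ.verts 1 + m) 1 := by
        rw [MvPolynomial.X, MvPolynomial.monomial_mul, one_mul]
      rw [h', withColours_monomial]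
      congr 2
      ext φ
      simp only [Finset.mem_insert, Finsupp.mem_support_iff, Finsupp.add_apply,
        Finsupp.single_apply]
      by_cases hφ : φ = Γ.verts
      · simp [hφ]
      · simp [hφ, Ne.symm hφ]
  exact LinearMap.congr_fun key p

/-! ### The forest formula -/

/-- The sum over the forests of divergent subgraphs, each with its sign. -/
def forestSum (P : Finset (Finset T.Vertex)) : MvPolynomial (Finset T.Vertex) ℂ :=
  indepSum NonOverlapping P (fun S => - MvPolynomial.X S)

/-- Some part of `Γ` is a self-energy. -/
def Graph.HasSelfEnergyPart (Γ : Graph T) : Prop := ∃ S ∈ Γ.parts, (Γ.sub S).legs.card = 2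

open scoped Classical in
/-- The closed formula for the twisted antipode. -/
def antipodeColours (Θ : ExternalChange T) (Γ : Graph T) : MvPolynomial (Finset T.Vertex) ℂ :=
  if Γ.HasSelfEnergyPart then 0 else - (wholeColour Θ Γ * forestSum Γ.parts)

theorem wholeColour_of_selfEnergy (Θ : ExternalChange T) {Γ : Graph T} (h : Γ.legs.card = 2) :
    wholeColour Θ Γ = 1 := by
  rw [wholeColour, if_pos (Θ.trivial_on_selfEnergy _ h)]

/-- Here nontriviality of `Θ` on divergent vertex graphs enters: it ensures that every vertex part
carries a colour, and thus its own variable in the forest sum. -/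
theorem wholeColour_of_vertex (Θ : ExternalChange T) {Γ : Graph T} (h : Γ.Is1PI)
    (hdeg : 0 ≤ Γ.degree) (hne : Γ.legs.card ≠ 2) :
    wholeColour Θ Γ = MvPolynomial.X Γ.verts := by
  rw [wholeColour, if_neg (Θ.nontrivial_on_vertex Γ h
    (lt_of_le_of_ne h.two_le_legs hne.symm) hdeg)]

/-- The disjoint parts of a family are the maximal elements of a forest, and the weight of each
already sums over the forests below it. -/
theorem indepSum_antipodeColours_of_not {Θ : ExternalChange T} {Γ : Graph T}
    (h : ¬ Γ.HasSelfEnergyPart) :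
    indepSum Disjoint Γ.parts (fun S => antipodeColours Θ (Γ.sub S)) = forestSum Γ.parts := by
  classical
  unfold forestSum
  rw [indepSum_nonOverlapping_eq _ fun S hS => Graph.nonempty_of_mem_parts hS]
  refine indepSum_congr fun S hS => ?_
  have h1 := Graph.mem_parts.1 hS
  rw [antipodeColours, if_neg, wholeColour_of_vertex Θ h1.2.2.1 h1.2.2.2.1 fun h' => h ⟨S, hS, h'⟩,
    Graph.parts_sub h1.1, forestSum, neg_mul]
  · rfl
  · rintro ⟨S', hS', hc⟩
    rw [Graph.parts_sub h1.1, Finset.mem_filter] at hS'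
    rw [Graph.sub_sub hS'.2.subset] at hc
    exact h ⟨S', hS'.1, hc⟩

theorem indepSum_antipodeColours_of_hasSelfEnergyPart {Θ : ExternalChange T} {Γ : Graph T}
    (hoverlap : ∀ S ∈ Γ.parts, ∀ S' ∈ Γ.parts, (Γ.sub S).legs.card = 2 → NonOverlapping S S')
    (h : Γ.HasSelfEnergyPart) :
    indepSum Disjoint Γ.parts (fun S => antipodeColours Θ (Γ.sub S)) = 0 := by
  classical
  -- Minimality leaves no self-energy part inside `A`, so the nonzero branch of the closed formula
  -- applies to `A` itself.
  obtain ⟨A, hA, hmin⟩ := Finset.exists_min_image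
    (Γ.parts.filter fun S => (Γ.sub S).legs.card = 2) Finset.card
    (by obtain ⟨S, hS, hc⟩ := h; exact ⟨S, Finset.mem_filter.2 ⟨hS, hc⟩⟩)
  rw [Finset.mem_filter] at hA
  have h1 := Graph.mem_parts.1 hA.1
  refine indepSum_disjoint_eq_zero (fun S hS => Graph.nonempty_of_mem_parts hS) hA.1
    (fun S hS => hoverlap A hA.1 S hS hA.2) (fun S hS hAS => ?_) ?_
  -- A part strictly above `A` has `A` as a self-energy part, so its antipode vanishes.
  · rw [antipodeColours, if_pos]
    refine ⟨A, ?_, ?_⟩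
    · rw [Graph.parts_sub (Graph.mem_parts.1 hS).1, Finset.mem_filter]
      exact ⟨hA.1, hAS⟩
    · rw [Graph.sub_sub hAS.subset]
      exact hA.2
  · have hno : ¬ (Γ.sub A).HasSelfEnergyPart := by
      rintro ⟨S, hS, hc⟩
      rw [Graph.parts_sub h1.1, Finset.mem_filter] at hS
      rw [Graph.sub_sub hS.2.subset] at hc
      exact absurd (Finset.card_lt_card hS.2)
        (not_lt.2 (hmin S (Finset.mem_filter.2 ⟨hS.1, hc⟩)))
    -- No colour factor appears on two legs: the weight of `A` is exactly minus its forest sum,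
    -- rewritten as a sum over disjoint families inside `A`.
    rw [antipodeColours, if_neg hno, wholeColour_of_selfEnergy Θ hA.2, one_mul,
      ← indepSum_antipodeColours_of_not (Θ := Θ) hno, Graph.parts_sub h1.1]
    congr 1
    refine indepSum_congr fun S hS => ?_
    rw [Graph.sub_sub (Finset.mem_filter.1 hS).2.subset]

theorem preparation_of_parts {Θ : ExternalChange T} {Γ : Graph T} (hΓ : Γ.IsFeynman)
    (hoverlap : ∀ S ∈ Γ.parts, ∀ S' ∈ Γ.parts, (Γ.sub S).legs.card = 2 → NonOverlapping S S')
    (hz : ∀ S ∈ Γ.parts, twistedAntipode Θ (Γ.sub S) =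
      withColours (Γ.sub S) (antipodeColours Θ (Γ.sub S))) [Decidable Γ.HasSelfEnergyPart] :
    preparation Θ Γ = withColours Γ (if Γ.HasSelfEnergyPart then 0 else forestSum Γ.parts) := by
  rw [preparation_eq hΓ hz]
  split_ifs with h
  · rw [indepSum_antipodeColours_of_hasSelfEnergyPart hoverlap h]
  · rw [indepSum_antipodeColours_of_not h]

/-- Induction on the number of vertices; the condition on overlaps is inherited by every part. -/
theorem twistedAntipode_eq {Θ : ExternalChange T} {Γ : Graph T} (hΓ : Γ.IsFeynman)
    (hoverlap : ∀ S ∈ Γ.parts, ∀ S' ∈ Γ.parts, (Γ.sub S).legs.card = 2 → NonOverlapping S S') :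
    twistedAntipode Θ Γ = withColours Γ (antipodeColours Θ Γ) := by
  classical
  induction hn : Γ.verts.card using Nat.strong_induction_on generalizing Γ with
  | _ n ih =>
    have hz : ∀ S ∈ Γ.parts, twistedAntipode Θ (Γ.sub S) =
        withColours (Γ.sub S) (antipodeColours Θ (Γ.sub S)) := by
      intro S hS
      have h1 := Graph.mem_parts.1 hS
      refine ih (Γ.sub S).verts.card ?_ h1.2.2.1.feynman ?_ rfl
      · rw [← hn]
        exact Finset.card_lt_card (Graph.ssubset_of_mem_parts hS)
      · intro A hA B hB hc
        rw [Graph.parts_sub h1.1, Finset.mem_filter] at hA hB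
        rw [Graph.sub_sub hA.2.subset] at hc
        exact hoverlap A hA.1 B hB.1 hc
    rw [twistedAntipode_eq_neg, preparation_of_parts hΓ hoverlap hz, rename_colour_withColours,
      ← map_neg, antipodeColours]
    split_ifs <;> simp

open scoped Classical in
theorem preparation_closed {Θ : ExternalChange T} {Γ : Graph T} (hΓ : Γ.IsFeynman)
    (hoverlap : ∀ S ∈ Γ.parts, ∀ S' ∈ Γ.parts, (Γ.sub S).legs.card = 2 → NonOverlapping S S') :
    preparation Θ Γ = withColours Γ (if Γ.HasSelfEnergyPart then 0 else forestSum Γ.parts) := by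
  refine preparation_of_parts hΓ hoverlap fun S hS => ?_
  have h1 := Graph.mem_parts.1 hS
  refine twistedAntipode_eq h1.2.2.1.feynman fun A hA B hB hc => ?_
  rw [Graph.parts_sub h1.1, Finset.mem_filter] at hA hB
  rw [Graph.sub_sub hA.2.subset] at hc
  exact hoverlap A hA.1 B hB.1 hc

/-! ### Multilinear algebra -/

section Algebra

theorem sub_mem_ideal_congr {A : Type*} [CommRing A] {I : Ideal A} {x x' y y' : A} (hx : x = x') (hy : y = y')
    (h : x' - y' ∈ I) : x - y ∈ I := by
  rwa [hx, hy]

theorem sub_mem_ideal_of_eq {A : Type*} [CommRing A] (I : Ideal A) {x y : A} (h : x = y) : x - y ∈ I := by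
  rw [h, sub_self]
  exact I.zero_mem

variable {A B ι : Type*} [CommRing A] [Algebra ℂ A] [CommRing B] [Algebra ℂ B]

theorem aeval_withColours_forestSum (h : CGraph T → A) (Γ : Graph T)
    (P : Finset (Finset T.Vertex)) :
    MvPolynomial.aeval h (withColours Γ (forestSum P)) =
      ∑ F ∈ indepSets NonOverlapping P, (-1 : ℂ) ^ F.card • h ⟨Γ, F⟩ := by
  classical
  unfold forestSum indepSum
  rw [map_sum, map_sum]
  refine Finset.sum_congr rfl fun F _ => ?_
  have h : ∏ S ∈ F, (- MvPolynomial.X S : MvPolynomial (Finset T.Vertex) ℂ) =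
      (-1 : ℂ) ^ F.card • MvPolynomial.monomial (∑ S ∈ F, Finsupp.single S 1) 1 := by
    have := prod_monomial_one F fun S => Finsupp.single S 1
    rw [← this, Finset.prod_neg, MvPolynomial.smul_eq_C_mul, MvPolynomial.C_pow, map_neg,
      MvPolynomial.C_1]
    rfl
  have hsupp : (∑ S ∈ F, Finsupp.single S 1 : Finset T.Vertex →₀ ℕ).support = F := by
    rw [support_sum_nat]
    ext S
    simp [eq_comm]
  rw [h, map_smul, withColours_monomial, hsupp, map_smul, MvPolynomial.aeval_X]

theorem map_prod_congr (π : A →ₐ[ℂ] B) {s : Finset ι} {x y : ι → A}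
    (h : ∀ i ∈ s, π (x i) = π (y i)) : π (∏ i ∈ s, x i) = π (∏ i ∈ s, y i) := by
  rw [map_prod, map_prod]
  exact Finset.prod_congr rfl h

theorem map_tensor_sum {E : Type*} [AddCommMonoid E] [Module ℂ E] {κ : ι → Type*}
    (π : A →ₐ[ℂ] B) (s : Finset ι) (K : ∀ i, Finset (κ i)) (a : ∀ i, κ i → A)
    (g : ∀ i, κ i → E →ₗ[ℂ] A) (σ : E) :
    Algebra.TensorProduct.map π (AlgHom.id ℂ A)
      ((∑ i ∈ s, ∑ k ∈ K i, (TensorProduct.mk ℂ A A (a i k)).comp (g i k)) σ) =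
      ∑ i ∈ s, ∑ k ∈ K i, π (a i k) ⊗ₜ[ℂ] g i k σ := by
  simp only [LinearMap.sum_apply, map_sum, LinearMap.comp_apply, TensorProduct.mk_apply,
    Algebra.TensorProduct.map_tmul, AlgHom.id_apply]

/-- The terms `1 ⊗ X` are subtracted and the reduced coproducts cancel in total, so only `π(X) ⊗ 1`
survives. -/
theorem map_coproduct_sum_sub (π : A →ₐ[ℂ] B) (Δ : A →ₐ[ℂ] A ⊗[ℂ] A) (s : Finset ι) (c : ι → ℂ)
    (g : ι → A) (r : ι → B ⊗[ℂ] A)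
    (h : ∀ i ∈ s, ∃ x, Δ (g i) = g i ⊗ₜ 1 + 1 ⊗ₜ g i + x ∧
      Algebra.TensorProduct.map π (AlgHom.id ℂ A) x = r i)
    (h0 : ∑ i ∈ s, c i • r i = 0) :
    (((Algebra.TensorProduct.map π (AlgHom.id ℂ A)).comp Δ).toLinearMap -
      TensorProduct.mk ℂ B A 1) (∑ i ∈ s, c i • g i) = π (∑ i ∈ s, c i • g i) ⊗ₜ[ℂ] 1 := by
  rw [map_sum, map_sum, TensorProduct.sum_tmul, ← add_zero (∑ i ∈ s, _ ⊗ₜ[ℂ] _), ← h0,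
    ← Finset.sum_add_distrib]
  refine Finset.sum_congr rfl fun i hi => ?_
  obtain ⟨x, hx, hr⟩ := h i hi
  rw [map_smul, map_smul, ← TensorProduct.smul_tmul', ← smul_add]
  congr 1
  simp only [LinearMap.sub_apply, AlgHom.toLinearMap_apply, AlgHom.comp_apply, hx, map_add,
    Algebra.TensorProduct.map_tmul, map_one, AlgHom.id_apply, TensorProduct.mk_apply, hr]
  abel

/-- Over a field, injectivity of `ℂ → A` is preserved by tensoring with `B`. -/
theorem tmul_one_ne_zero [Nontrivial A] {b : B} (hb : b ≠ 0) : b ⊗ₜ[ℂ] (1 : A) ≠ 0 := by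
  intro h
  refine hb (Algebra.TensorProduct.includeLeft_injective (R := ℂ) (S := ℂ) (A := B) (B := A)
    (FaithfulSMul.algebraMap_injective ℂ A) ?_)
  rw [map_zero]
  exact h

theorem sum_smul_sum_sum_ite {M : Type*} [AddCommGroup M] [Module ℂ M] {κ : Type*}
    {τ : κ → Type*} (G : Finset ι) (c : ι → ℂ) (s : Finset κ) (K : ∀ j, Finset (τ j))
    (p : ι → κ → Prop) [∀ i j, Decidable (p i j)] (t : ι → ∀ j, τ j → M)
    (h : ∀ j ∈ s, ∀ k ∈ K j, ∑ i ∈ G, (if p i j then c i • t i j k else 0) = 0) :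
    ∑ i ∈ G, c i • ∑ j ∈ s with p i j, ∑ k ∈ K j, t i j k = 0 := by
  have h1 : ∀ i ∈ G, c i • ∑ j ∈ s with p i j, ∑ k ∈ K j, t i j k =
      ∑ j ∈ s, ∑ k ∈ K j, if p i j then c i • t i j k else 0 := by
    intro i _
    rw [Finset.sum_filter, Finset.smul_sum]
    refine Finset.sum_congr rfl fun j _ => ?_
    split_ifs
    · rw [Finset.smul_sum]
    · rw [smul_zero, Finset.sum_const_zero]
  rw [Finset.sum_congr rfl h1, Finset.sum_comm]
  refine Finset.sum_eq_zero fun j hj => ?_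
  rw [Finset.sum_comm]
  exact Finset.sum_eq_zero (h j hj)

open scoped Classical in
/-- Forests with and without a given set `S` cancel. -/
theorem sum_forests_ite_eq_zero {M : Type*} [AddCommGroup M] [Module ℂ M]
    {P s : Finset (Finset T.Vertex)} {S : Finset T.Vertex} (hSP : S ∈ P) (hS : S ∈ s)
    (hdis : ∀ S ∈ s, ∀ S' ∈ s, S ≠ S' → Disjoint S S') (t : Finset (Finset T.Vertex) → M)
    (ht : ∀ F, S ∉ F → t (insert S F) = t F) :
    ∑ F ∈ indepSets NonOverlapping P, (if ∀ S ∈ s, ∀ φ ∈ F, NonOverlapping S φ then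
      (-1 : ℂ) ^ F.card • t F else 0) = 0 := by
  obtain ⟨Q, hSQ, rfl⟩ : ∃ Q, S ∉ Q ∧ insert S Q = P :=
    ⟨P.erase S, by simp, Finset.insert_erase hSP⟩
  -- Toggling `S` changes no condition: compatibility of `S` with `F` is already demanded because `S
  -- ∈ s`, and the other members of `s` are disjoint from `S`.
  have hcond : ∀ F : Finset (Finset T.Vertex), S ∉ F →
      ((((insert S F : Finset (Finset T.Vertex)) : Set (Finset T.Vertex)).Pairwise
          NonOverlapping ∧ ∀ S' ∈ s, ∀ φ ∈ insert S F, NonOverlapping S' φ) ↔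
        ((F : Set (Finset T.Vertex)).Pairwise NonOverlapping ∧
          ∀ S' ∈ s, ∀ φ ∈ F, NonOverlapping S' φ)) := by
    intro F hF
    rw [Finset.coe_insert, Set.pairwise_insert_of_symm_of_notMem (by exact_mod_cast hF)]
    constructor
    · rintro ⟨⟨h1, -⟩, h2⟩
      exact ⟨h1, fun S' hS' φ hφ => h2 S' hS' φ (Finset.mem_insert_of_mem hφ)⟩
    · rintro ⟨h1, h2⟩
      refine ⟨⟨h1, h2 S hS⟩, fun S' hS' φ hφ => ?_⟩
      rcases Finset.mem_insert.1 hφ with rfl | hφ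
      · by_cases he : S' = φ
        · exact he ▸ nonOverlapping_refl S'
        · exact Or.inr (Or.inr (hdis S' hS' φ hS he))
      · exact h2 S' hS' φ hφ
  unfold indepSets
  rw [Finset.sum_filter, Finset.sum_powerset_insert hSQ, ← Finset.sum_add_distrib]
  refine Finset.sum_eq_zero fun F hF => ?_
  have hSF : S ∉ F := fun h => hSQ (Finset.mem_powerset.1 hF h)
  simp only [← ite_and, hcond F hSF, ht F hSF, Finset.card_insert_of_notMem hSF]
  split_ifs
  · rw [pow_succ, ← add_smul]
    simp
  · simp

-- After exchanging the sums, the family `s` is fixed and any one of its members can be toggled in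
-- the forest, which reverses the sign and leaves the term unchanged.
open scoped Classical in
theorem map_coproduct_forest_sum (π : A →ₐ[ℂ] B) (Δ : A →ₐ[ℂ] A ⊗[ℂ] A)
    {P : Finset (Finset T.Vertex)} {D : Finset (Finset (Finset T.Vertex))}
    (g : Finset (Finset T.Vertex) → A) {τ : Finset (Finset T.Vertex) → Type*}
    (K : ∀ s, Finset (τ s)) (t : Finset (Finset T.Vertex) → ∀ s, τ s → B ⊗[ℂ] A)
    (h : ∀ F ∈ indepSets NonOverlapping P, ∃ x, Δ (g F) = g F ⊗ₜ 1 + 1 ⊗ₜ g F + x ∧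
      Algebra.TensorProduct.map π (AlgHom.id ℂ A) x =
        ∑ s ∈ D with ∀ S ∈ s, ∀ φ ∈ F, NonOverlapping S φ, ∑ k ∈ K s, t F s k)
    (hD : ∀ s ∈ D, s ⊆ P ∧ s.Nonempty ∧ ∀ S ∈ s, ∀ S' ∈ s, S ≠ S' → Disjoint S S')
    (ht : ∀ s ∈ D, ∀ S ∈ s, ∀ F, S ∉ F → ∀ k, t (insert S F) s k = t F s k) :
    (((Algebra.TensorProduct.map π (AlgHom.id ℂ A)).comp Δ).toLinearMap -
      TensorProduct.mk ℂ B A 1) (∑ F ∈ indepSets NonOverlapping P, (-1 : ℂ) ^ F.card • g F) =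
      π (∑ F ∈ indepSets NonOverlapping P, (-1 : ℂ) ^ F.card • g F) ⊗ₜ[ℂ] 1 := by
  have h0 : ∑ F ∈ indepSets NonOverlapping P, (-1 : ℂ) ^ F.card •
      ∑ s ∈ D with ∀ S ∈ s, ∀ φ ∈ F, NonOverlapping S φ, ∑ k ∈ K s, t F s k = 0 := by
    refine sum_smul_sum_sum_ite (indepSets NonOverlapping P) (fun F => (-1 : ℂ) ^ F.card) D K
      (fun F s => ∀ S ∈ s, ∀ φ ∈ F, NonOverlapping S φ) t fun s hs k _ => ?_
    have hS := (hD s hs).2.1.choose_spec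
    exact sum_forests_ite_eq_zero ((hD s hs).1 hS) hS (hD s hs).2.2 (fun F => t F s k)
      fun F hF => ht s hs _ hS F hF k
  exact map_coproduct_sum_sub π Δ (indepSets NonOverlapping P) (fun F => (-1 : ℂ) ^ F.card) g
    (fun F => ∑ s ∈ D with ∀ S ∈ s, ∀ φ ∈ F, NonOverlapping S φ, ∑ k ∈ K s, t F s k) h h0

theorem map_one_sub_one_tmul (f : A →ₐ[ℂ] B ⊗[ℂ] A) :
    (f.toLinearMap - TensorProduct.mk ℂ B A 1) 1 = 0 := by
  simp [Algebra.TensorProduct.one_def]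

open scoped Classical in
/-- The forest sum `X` has bidegree at most one, and `X` modulo `I` is the obstruction to bidegree
zero. -/
theorem forest_sum_bidegree (I : Ideal A) [Nontrivial A] (Δ : A →ₐ[ℂ] A ⊗[ℂ] A) {E M : Type*}
    [AddCommMonoid E] [Module ℂ E] (σ : E) {P : Finset (Finset T.Vertex)}
    {D : Finset (Finset (Finset T.Vertex))} (g : Finset (Finset T.Vertex) → A)
    (K : ∀ s : Finset (Finset T.Vertex), Finset (∀ S ∈ s, M))
    (comp : Finset (Finset T.Vertex) → Finset T.Vertex → M → A)
    (cog : Finset (Finset T.Vertex) → ∀ s : Finset (Finset T.Vertex), (∀ S ∈ s, M) → E →ₗ[ℂ] A)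
    (h : ∀ F ∈ indepSets NonOverlapping P, Δ (g F) = g F ⊗ₜ 1 + 1 ⊗ₜ g F +
      (∑ s ∈ D with ∀ S ∈ s, ∀ φ ∈ F, NonOverlapping S φ, ∑ k ∈ K s,
        (TensorProduct.mk ℂ A A (∏ S ∈ s.attach, comp F S.1 (k S.1 S.2))).comp (cog F s k)) σ)
    (hD : ∀ s ∈ D, s ⊆ P ∧ s.Nonempty ∧ ∀ S ∈ s, ∀ S' ∈ s, S ≠ S' → Disjoint S S')
    (hcomp : ∀ s ∈ D, ∀ S ∈ s, ∀ S' ∈ s, ∀ F, S ∉ F → ∀ m,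
      comp (insert S F) S' m - comp F S' m ∈ I)
    (hcog : ∀ s ∈ D, ∀ S ∈ s, ∀ F, S ∉ F → ∀ k, cog (insert S F) s k = cog F s k)
    {L : A →ₗ[ℂ] (A ⧸ I) ⊗[ℂ] A} (hL : L =
      ((Algebra.TensorProduct.map (Ideal.Quotient.mkₐ ℂ I) (AlgHom.id ℂ A)).comp Δ).toLinearMap -
        TensorProduct.mk ℂ (A ⧸ I) A 1) {X : A}
    (hX : X = ∑ F ∈ indepSets NonOverlapping P, (-1 : ℂ) ^ F.card • g F) :
    (X ∈ I → X ∈ LinearMap.ker L) ∧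
    -X ∈ (LinearMap.range (LinearMap.lTensor (A ⧸ I) (LinearMap.ker L).subtype)).comap L ∧
    (X ∉ I → -X ∉ LinearMap.ker L) := by
  -- Modulo `I` the components ignore the colour of `S`, and the cograph ignores it exactly; hence
  -- the terms are invariant under toggling.
  have key : L X = Ideal.Quotient.mkₐ ℂ I X ⊗ₜ[ℂ] 1 := by
    rw [hL, hX]
    refine map_coproduct_forest_sum (Ideal.Quotient.mkₐ ℂ I) Δ g K
      (fun F s k => Ideal.Quotient.mkₐ ℂ I (∏ S ∈ s.attach, comp F S.1 (k S.1 S.2)) ⊗ₜ[ℂ]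
        cog F s k σ)
      (fun F hF => ⟨_, h F hF, map_tensor_sum _ _ _ _ _ _⟩) hD fun s hs S hS F hF k => ?_
    rw [hcog s hs S hS F hF k, map_prod_congr _ fun S' _ =>
      Ideal.Quotient.eq.2 (hcomp s hs S hS S'.1 S'.2 F hF (k S'.1 S'.2))]
  have hmem : X ∈ I ↔ Ideal.Quotient.mkₐ ℂ I X = 0 := Ideal.Quotient.eq_zero_iff_mem.symm
  have hone : L 1 = 0 := hL ▸ map_one_sub_one_tmul _
  refine ⟨fun hI => ?_, ?_, fun hI hker => ?_⟩
  · rw [LinearMap.mem_ker, key, hmem.1 hI, TensorProduct.zero_tmul]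
  · rw [Submodule.mem_comap, map_neg, key, ← TensorProduct.neg_tmul]
    -- The image has last factor `1`, which `L` annihilates; this is why a second application gives
    -- zero.
    exact ⟨(-Ideal.Quotient.mkₐ ℂ I X) ⊗ₜ ⟨1, hone⟩, by simp⟩
  · rw [LinearMap.mem_ker, map_neg, key, neg_eq_zero] at hker
    exact tmul_one_ne_zero (fun h0 => hI (hmem.2 h0)) hker

end Algebra

/-! ### The forest sums as specified graphs -/

/-- The signed sum over the forests of `Γ`, as a linear combination of specified graphs. -/
def forestElement (Γ : Graph T) (σ : ExtStr T.D Γ.legs) : SpecAlg T :=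
  ∑ F ∈ indepSets NonOverlapping Γ.parts, (-1 : ℂ) ^ F.card • gen Γ.legs ⟨Γ, F⟩ σ

theorem sum_smul_map_sub {E M ι : Type*} [AddCommGroup E] [Module ℂ E] [AddCommGroup M]
    [Module ℂ M] (s : Finset ι) (c : ι → ℂ) (g : ι → E →ₗ[ℂ] M) (x y : E) :
    ∑ i ∈ s, c i • g i (x - y) = ∑ i ∈ s, c i • g i x - ∑ i ∈ s, c i • g i y := by
  simp [smul_sub]

theorem forestElement_sub (Γ : Graph T) (σ τ : ExtStr T.D Γ.legs) :
    forestElement Γ (σ - τ) = forestElement Γ σ - forestElement Γ τ :=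
  sum_smul_map_sub (indepSets NonOverlapping Γ.parts) (fun F => (-1 : ℂ) ^ F.card)
    (fun F => gen Γ.legs ⟨Γ, F⟩) σ τ

theorem verts_notMem_forest {Γ : Graph T} {F : Finset (Finset T.Vertex)}
    (hF : F ∈ indepSets NonOverlapping Γ.parts) : Γ.verts ∉ F :=
  fun h => (Graph.mem_parts.1 ((mem_indepSets.1 hF).1 h)).2.1 rfl

theorem specify_forestSum (Θ : ExternalChange T) (Γ : Graph T) (σ : ExtStr T.D Γ.legs) :
    specify Θ Γ.legs σ (withColours Γ (forestSum Γ.parts)) = forestElement Γ σ := by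
  classical
  refine (aeval_withColours_forestSum _ Γ Γ.parts).trans ?_
  refine Finset.sum_congr rfl fun F hF => ?_
  have h := verts_notMem_forest hF
  simp only [if_neg h, CGraph.inner, Finset.erase_eq_of_notMem h]

/-- If `Θ` is the identity on these legs, no colour is added and `Θσ = σ`. Otherwise the colour of
the whole graph is removed by `inner` and passed on to `σ`. -/
theorem specify_rename_forestSum (Θ : ExternalChange T) (Γ : Graph T)
    (σ : ExtStr T.D Γ.legs) :
    specify Θ Γ.legs σ (MvPolynomial.rename (CGraph.colour Θ)
      (withColours Γ (forestSum Γ.parts))) = forestElement Γ (Θ.map Γ.legs σ) := by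
  classical
  refine (MvPolynomial.aeval_rename _ _ _).trans ?_
  refine (aeval_withColours_forestSum _ Γ Γ.parts).trans ?_
  refine Finset.sum_congr rfl fun F hF => ?_
  have h := verts_notMem_forest hF
  simp only [Function.comp_apply]
  unfold CGraph.colour
  by_cases h1 : Θ.map Γ.legs = LinearMap.id
  · simp only [if_pos h1, if_neg h, CGraph.inner, Finset.erase_eq_of_notMem h]
    have e : Θ.map Γ.legs σ = σ := by rw [h1]; rfl
    exact congrArg (fun τ => (-1 : ℂ) ^ F.card • gen Γ.legs ⟨Γ, F⟩ τ) e.symm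
  · simp only [if_neg h1, if_pos (Finset.mem_insert_self _ _), CGraph.inner,
      Finset.erase_insert h]

theorem good_of_mem_indepSets {Γ : Graph T} (hΓ : Γ.Is1PI) {F : Finset (Finset T.Vertex)}
    (hF : F ∈ indepSets NonOverlapping Γ.parts) : CGraph.Good ⟨Γ, F⟩ := by
  obtain ⟨h, hp⟩ := mem_indepSets.1 hF
  refine ⟨hΓ, fun φ hφ => Graph.ssubset_of_mem_parts (h hφ),
    fun φ hφ => (Graph.mem_parts.1 (h hφ)).2.2.1, fun φ hφ ψ hψ => ?_⟩
  by_cases he : φ = ψ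
  · exact he ▸ nonOverlapping_refl φ
  · exact hp hφ hψ he

open scoped Classical in
theorem gen_index (i : SpecIndex T) (σ : ExtStr T.D i.L) :
    gen i.L i.c σ = SymmetricAlgebra.ι ℂ (SpecSpace T)
      (DirectSum.lof ℂ (SpecIndex T) (fun i => ExtStr T.D i.L) i σ) := by
  have h : gen i.L i.c = (SymmetricAlgebra.ι ℂ (SpecSpace T)).comp
      (DirectSum.lof ℂ (SpecIndex T) (fun i => ExtStr T.D i.L) i) :=
    dif_pos ⟨i.good, i.legs_eq⟩
  exact congrArg (fun g : ExtStr T.D i.L →ₗ[ℂ] SpecAlg T => g σ) h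

theorem gen_eq_zero {L : Finset T.HalfEdge} {c : CGraph T} (h : ¬ (c.Good ∧ c.graph.legs = L))
    (σ : ExtStr T.D L) : gen L c σ = 0 := by
  have h : gen L c = 0 := dif_neg h
  exact congrArg (fun g : ExtStr T.D L →ₗ[ℂ] SpecAlg T => g σ) h

theorem coproduct_gen (Θ : ExternalChange T) (i : SpecIndex T) (σ : ExtStr T.D i.L) :
    coproduct Θ (gen i.L i.c σ) = coproductGen Θ i σ := by
  classical
  refine (congrArg (coproduct Θ) (gen_index i σ)).trans ?_
  refine (SymmetricAlgebra.lift_ι_apply _ _).trans ?_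
  exact DirectSum.toModule_lof (M := fun i => ExtStr T.D i.L) (φ := coproductGen Θ) ℂ i σ

/-! ### Superficial convergence -/

/-- With two legs `Θ` is the identity; with more, it preserves the divergent Taylor terms by
assumption. Convergence of `σ - Θσ` follows for all 1PI graphs. -/
theorem map_apply_of_isPoly (Θ : ExternalChange T) {Γ : Graph T} (hΓ : Γ.Is1PI)
    (σ : ExtStr T.D Γ.legs) {f : MomentumFn T.D Γ.legs} (hf : IsPolyOfDegreeLE f Γ.degree) :
    (Θ.map Γ.legs σ).1 f = σ.1 f := by
  rcases hΓ.two_le_legs.eq_or_lt with h | h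
  · rw [Θ.trivial_on_selfEnergy _ h.symm, LinearMap.id_apply]
  · exact Θ.preserves_divergence Γ hΓ h σ f hf

theorem superficiallyConvergent_sub_map (Θ : ExternalChange T) {Γ : Graph T} (hΓ : Γ.Is1PI)
    (σ : ExtStr T.D Γ.legs) : SuperficiallyConvergent Γ (σ - Θ.map Γ.legs σ) := by
  intro f hf
  exact sub_eq_zero.2 (map_apply_of_isPoly Θ hΓ σ hf).symm

theorem superficiallyConvergent_map_sub (Θ : ExternalChange T) {Γ : Graph T} (hΓ : Γ.Is1PI)
    (σ : ExtStr T.D Γ.legs) : SuperficiallyConvergent Γ (Θ.map Γ.legs σ - σ) := by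
  intro f hf
  exact sub_eq_zero.2 (map_apply_of_isPoly Θ hΓ σ hf)

theorem gen_mem_convergentIdeal {L : Finset T.HalfEdge} (c : CGraph T) {σ : ExtStr T.D L}
    (hσ : SuperficiallyConvergent c.graph σ) : gen L c σ ∈ convergentIdeal T := by
  by_cases h : c.Good ∧ c.graph.legs = L
  · exact Ideal.subset_span ⟨⟨L, c, h.1, h.2⟩, σ, hσ, rfl⟩
  · exact (gen_eq_zero h σ).symm ▸ (convergentIdeal T).zero_mem

theorem sum_smul_mem_ideal {A ι : Type*} [CommRing A] [Algebra ℂ A] (I : Ideal A) (s : Finset ι)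
    (c : ι → ℂ) {g : ι → A} (h : ∀ i ∈ s, g i ∈ I) : ∑ i ∈ s, c i • g i ∈ I :=
  Ideal.sum_mem _ fun i hi => by
    rw [Algebra.smul_def]
    exact I.mul_mem_left _ (h i hi)

/-- Superficial convergence sees only the uncoloured graph and `σ`, so all terms of the forest sum
are convergent together. -/
theorem forestElement_mem_convergentIdeal {Γ : Graph T} {σ : ExtStr T.D Γ.legs}
    (hσ : SuperficiallyConvergent Γ σ) : forestElement Γ σ ∈ convergentIdeal T :=
  sum_smul_mem_ideal _ _ _ fun F _ => gen_mem_convergentIdeal ⟨Γ, F⟩ hσ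

/-! ### Characters that detect superficial divergence -/

/-- Evaluation of the external structure on `f`, on the specified graphs of one kind. -/
def evalGen (i : SpecIndex T) (f : MomentumFn T.D i.L) : SpecAlg T →ₐ[ℂ] ℂ :=
  SymmetricAlgebra.lift ((LinearMap.applyₗ f).comp ((ExtStr T.D i.L).subtype.comp
    (DirectSum.component ℂ (SpecIndex T) (fun i => ExtStr T.D i.L) i)))

theorem evalGen_gen_self (i : SpecIndex T) (f : MomentumFn T.D i.L) (σ : ExtStr T.D i.L) :
    evalGen i f (gen i.L i.c σ) = σ.1 f := by
  classical
  rw [gen_index]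
  refine (SymmetricAlgebra.lift_ι_apply _ _).trans ?_
  simp only [LinearMap.comp_apply, DirectSum.component.lof_self]
  rfl

theorem evalGen_gen_of_ne {i j : SpecIndex T} (h : j ≠ i) (f : MomentumFn T.D i.L)
    (σ : ExtStr T.D j.L) : evalGen i f (gen j.L j.c σ) = 0 := by
  classical
  rw [gen_index]
  refine (SymmetricAlgebra.lift_ι_apply _ _).trans ?_
  simp only [LinearMap.comp_apply, DirectSum.component.of, dif_neg h]
  rfl

/-- The evaluation is an algebra homomorphism, so it suffices to kill the generators: those of
another kind are sent to zero, and those of kind `i` to `σ f`, which vanishes by convergence. -/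
theorem evalGen_of_mem_convergentIdeal {i : SpecIndex T} {f : MomentumFn T.D i.L}
    (hf : IsPolyOfDegreeLE f i.c.graph.degree) {x : SpecAlg T} (hx : x ∈ convergentIdeal T) :
    evalGen i f x = 0 := by
  have hle : convergentIdeal T ≤ RingHom.ker (evalGen i f) := by
    refine Ideal.span_le.2 ?_
    rintro _ ⟨j, σ, hσ, rfl⟩
    change evalGen i f _ = 0
    by_cases h : j = i
    · subst h
      rw [evalGen_gen_self]
      exact hσ f hf
    · exact evalGen_gen_of_ne h f σ
  exact hle hx

theorem algHom_sum_smul {A ι : Type*} [CommRing A] [Algebra ℂ A] (ψ : A →ₐ[ℂ] ℂ) (s : Finset ι)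
    (c : ι → ℂ) (g : ι → A) : ψ (∑ i ∈ s, c i • g i) = ∑ i ∈ s, c i * ψ (g i) := by
  simp

/-- Different forests give different generators, so the evaluation at the uncoloured graph picks out
the empty forest, whose sign is `+1`. -/
theorem evalGen_forestElement {Γ : Graph T} (hΓ : Γ.Is1PI) (h0 : CGraph.Good ⟨Γ, ∅⟩)
    (f : MomentumFn T.D Γ.legs) (σ : ExtStr T.D Γ.legs) :
    evalGen ⟨Γ.legs, ⟨Γ, ∅⟩, h0, rfl⟩ f (forestElement Γ σ) = σ.1 f := by
  refine (algHom_sum_smul _ _ _ _).trans ?_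
  rw [Finset.sum_eq_single ∅]
  · rw [evalGen_gen_self ⟨Γ.legs, ⟨Γ, ∅⟩, h0, rfl⟩ f σ]
    simp
  · intro F hF hne
    rw [evalGen_gen_of_ne
      (i := ⟨Γ.legs, ⟨Γ, ∅⟩, h0, rfl⟩)
      (j := ⟨Γ.legs, ⟨Γ, F⟩, good_of_mem_indepSets hΓ hF, rfl⟩) ?_ f σ, mul_zero]
    exact fun h => hne (congrArg (fun i : SpecIndex T => i.c.colours) h)
  · exact fun h => absurd (empty_mem_indepSets _ _) h

/-! ### Cancellation of subdivergences -/

theorem not_ssubset_of_mem_subdivergences {Γ : Graph T} {s : Finset (Finset T.Vertex)}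
    (hs : s ∈ Γ.subdivergences) {S S' : Finset T.Vertex} (hS : S ∈ s) (hS' : S' ∈ s) :
    ¬ S ⊂ S' := by
  intro h
  have h1 := Graph.mem_subdivergences.1 hs
  obtain ⟨v, hv⟩ := Graph.nonempty_of_mem_parts (h1.1 hS)
  exact Finset.disjoint_left.1 (h1.2.2 S hS S' hS' h.ne) hv (h.subset hv)

theorem gen_map_sub_mem_convergentIdeal (Θ : ExternalChange T) (c : CGraph T)
    (hc : c.graph.Is1PI) (σ : ExtStr T.D c.graph.legs) :
    gen c.graph.legs c (Θ.map _ σ) - gen c.graph.legs c σ ∈ convergentIdeal T := by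
  have h := gen_mem_convergentIdeal c (superficiallyConvergent_map_sub Θ hc σ)
  have e := LinearMap.map_sub (gen c.graph.legs c) (Θ.map _ σ) σ
  exact e ▸ h

-- A component records only colours strictly inside it, and no member of a disjoint family lies
-- strictly inside another.
open scoped Classical in
theorem sub_insert {Γ : Graph T} {s : Finset (Finset T.Vertex)} (hs : s ∈ Γ.subdivergences)
    {S S' : Finset T.Vertex} (hS : S ∈ s) (hS' : S' ∈ s) (F : Finset (Finset T.Vertex)) :
    CGraph.sub ⟨Γ, insert S F⟩ S' = CGraph.sub ⟨Γ, F⟩ S' := by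
  simp only [CGraph.sub, Finset.filter_insert,
    if_neg (not_ssubset_of_mem_subdivergences hs hS hS')]

theorem component_eq_gen (Θ : ExternalChange T) (c : CGraph T) {c' : CGraph T}
    (S : Finset T.Vertex) (P : T.Mono) (hc : c.sub S = c') {σ : ExtStr T.D (c.graph.sub S).legs}
    (hσ : (open scoped Classical in
      if S ∈ c.colours then Θ.map _ (T.extStr P _) else T.extStr P _) = σ) :
    component Θ c S P = gen (c.graph.sub S).legs c' σ := by
  subst hc hσ
  rfl

-- Colouring `S` affects only the component `S` itself, by replacing its external structure with its
-- image under `Θ`; the difference is superficially convergent.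
open scoped Classical in
theorem component_insert_sub_mem (Θ : ExternalChange T) {Γ : Graph T}
    {s : Finset (Finset T.Vertex)} (hs : s ∈ Γ.subdivergences) {S S' : Finset T.Vertex}
    (hS : S ∈ s) (hS' : S' ∈ s) {F : Finset (Finset T.Vertex)} (hF : S ∉ F) (P : T.Mono) :
    component Θ ⟨Γ, insert S F⟩ S' P - component Θ ⟨Γ, F⟩ S' P ∈ convergentIdeal T := by
  have hsub := sub_insert hs hS hS' F
  by_cases h : S' = S
  · subst h
    exact sub_mem_ideal_congr
      (component_eq_gen Θ ⟨Γ, insert S' F⟩ S' P hsub (if_pos (Finset.mem_insert_self S' F)))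
      (component_eq_gen Θ ⟨Γ, F⟩ S' P rfl (if_neg hF))
      (gen_map_sub_mem_convergentIdeal Θ (CGraph.sub ⟨Γ, F⟩ S')
        (Graph.mem_parts.1 ((Graph.mem_subdivergences.1 hs).1 hS)).2.2.1 (T.extStr P _))
  · have hiff : S' ∈ insert S F ↔ S' ∈ F := by simp [h]
    exact sub_mem_ideal_of_eq _
      (component_eq_gen Θ ⟨Γ, insert S F⟩ S' P hsub (by simp only [hiff]))

-- `S` lies inside a shrunken component, namely itself, so its colour disappears from the cograph.
open scoped Classical in
theorem contract_insert {Γ : Graph T} {s : Finset (Finset T.Vertex)} {S : Finset T.Vertex}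
    (hS : S ∈ s) (F : Finset (Finset T.Vertex)) (k : ∀ S ∈ s, T.Mono) :
    CGraph.contract ⟨Γ, insert S F⟩ s k = CGraph.contract ⟨Γ, F⟩ s k := by
  have h : ¬ ∀ S' ∈ s, ¬ S ⊆ S' := fun h => h S hS (Finset.Subset.refl S)
  simp only [CGraph.contract, Finset.filter_insert, if_neg h]

/-! ### Bidegrees -/

open scoped Classical in
theorem forestElement_bidegree (Θ : ExternalChange T) {Γ : Graph T} (hΓ : Γ.Is1PI)
    (σ : ExtStr T.D Γ.legs) :
    (forestElement Γ σ ∈ convergentIdeal T → forestElement Γ σ ∈ bidegreeLE Θ 0) ∧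
    -forestElement Γ σ ∈ bidegreeLE Θ 1 ∧
    (forestElement Γ σ ∉ convergentIdeal T → -forestElement Γ σ ∉ bidegreeLE Θ 0) :=
  forest_sum_bidegree (P := Γ.parts) (D := Γ.subdivergences) (L := divergentParts Θ)
    (X := forestElement Γ σ) (convergentIdeal T) (coproduct Θ) σ (fun F => gen Γ.legs ⟨Γ, F⟩ σ)
    (fun s => s.pi (fun S => (Γ.sub S).monomials)) (fun F => component Θ ⟨Γ, F⟩)
    (fun F s k => gen Γ.legs (CGraph.contract ⟨Γ, F⟩ s k))
    (fun F hF => coproduct_gen Θ ⟨Γ.legs, ⟨Γ, F⟩, good_of_mem_indepSets hΓ hF, rfl⟩ σ)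
    (fun _ hs => Graph.mem_subdivergences.1 hs)
    (fun _ hs _ hS _ hS' _ hF P => component_insert_sub_mem Θ hs hS hS' hF P)
    (fun _ _ _ hS F _ k => congrArg (gen Γ.legs) (contract_insert hS F k)) rfl rfl

theorem bid_eq_zero {Θ : ExternalChange T} {x : SpecAlg T} (h : x ∈ bidegreeLE Θ 0) :
    bid Θ x = 0 := by
  refine le_antisymm ?_ zero_le
  exact iInf₂_le_of_le 0 h le_rfl

theorem bid_eq_one {Θ : ExternalChange T} {x : SpecAlg T} (h : x ∈ bidegreeLE Θ 1)
    (hne : x ∉ bidegreeLE Θ 0) : bid Θ x = 1 := by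
  -- The bidegree is an infimum over all admissible `n`, so excluding `n = 0` is enough for the
  -- lower bound.
  refine le_antisymm (iInf₂_le_of_le 1 h (by simp)) (le_iInf₂ fun n hn => ?_)
  rcases n with _ | n
  · exact absurd hn hne
  · simp

/-- A polynomial of degree at most `ω(Γ)` on which `σ` does not vanish gives a character that kills
the ideal; on this polynomial `Θσ` still has the value of `σ`. -/
theorem forestElement_notMem_convergentIdeal (Θ : ExternalChange T) {Γ : Graph T}
    (hΓ : Γ.Is1PI) {σ : ExtStr T.D Γ.legs} (hσ : ¬ SuperficiallyConvergent Γ σ) :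
    forestElement Γ (Θ.map Γ.legs σ) ∉ convergentIdeal T := by
  unfold SuperficiallyConvergent at hσ
  push Not at hσ
  obtain ⟨f, hf, hne⟩ := hσ
  intro h
  have h0 := good_of_mem_indepSets hΓ (empty_mem_indepSets _ Γ.parts)
  have h1 := evalGen_of_mem_convergentIdeal (i := ⟨Γ.legs, ⟨Γ, ∅⟩, h0, rfl⟩) hf h
  have h2 := evalGen_forestElement hΓ h0 f (Θ.map Γ.legs σ)
  exact hne ((map_apply_of_isPoly Θ hΓ σ hf).symm.trans (h2.symm.trans h1))

theorem specify_twistedAntipode {Θ : ExternalChange T} {Γ : Graph T} (hΓ : Γ.IsFeynman)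
    (hoverlap : ∀ S ∈ Γ.parts, ∀ S' ∈ Γ.parts, (Γ.sub S).legs.card = 2 → NonOverlapping S S')
    (hno : ¬ Γ.HasSelfEnergyPart) (σ : ExtStr T.D Γ.legs) :
    specify Θ Γ.legs σ (twistedAntipode Θ Γ) = - forestElement Γ (Θ.map Γ.legs σ) := by
  have e : twistedAntipode Θ Γ = - MvPolynomial.rename (CGraph.colour Θ)
      (withColours Γ (forestSum Γ.parts)) := by
    rw [twistedAntipode_eq_neg, preparation_closed hΓ hoverlap, if_neg hno]
  refine (congrArg (specify Θ Γ.legs σ) e).trans ?_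
  refine (map_neg (specify Θ Γ.legs σ) _).trans ?_
  exact congrArg Neg.neg (specify_rename_forestSum Θ Γ σ)

/-- The antipode contributes minus the forest sum at `Θσ` and the bracket contributes the forest sum
at `σ`; linearity in `σ` combines them. -/
theorem specify_twistedStarId {Θ : ExternalChange T} {Γ : Graph T} (hΓ : Γ.IsFeynman)
    (hoverlap : ∀ S ∈ Γ.parts, ∀ S' ∈ Γ.parts, (Γ.sub S).legs.card = 2 → NonOverlapping S S')
    (hno : ¬ Γ.HasSelfEnergyPart) (σ : ExtStr T.D Γ.legs) :
    specify Θ Γ.legs σ (twistedStarId Θ Γ) = forestElement Γ (σ - Θ.map Γ.legs σ) := by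
  have h1 := specify_twistedAntipode (Θ := Θ) hΓ hoverlap hno σ
  have h2 := specify_forestSum Θ Γ σ
  have e : twistedStarId Θ Γ = twistedAntipode Θ Γ + withColours Γ (forestSum Γ.parts) := by
    rw [twistedStarId_eq_add, preparation_closed hΓ hoverlap, if_neg hno]
  refine (congrArg (specify Θ Γ.legs σ) e).trans ?_
  refine (map_add (specify Θ Γ.legs σ) _ _).trans ?_
  refine (congrArg₂ (· + ·) h1 h2).trans ?_
  exact (neg_add_eq_sub _ _).trans (forestElement_sub Γ σ _).symm

theorem twistedAntipode_eq_zero {Θ : ExternalChange T} {Γ : Graph T} (hΓ : Γ.IsFeynman)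
    (hoverlap : ∀ S ∈ Γ.parts, ∀ S' ∈ Γ.parts, (Γ.sub S).legs.card = 2 → NonOverlapping S S')
    (h : Γ.HasSelfEnergyPart) : twistedAntipode Θ Γ = 0 := by
  rw [twistedAntipode_eq hΓ hoverlap, antipodeColours, if_pos h, map_zero]

theorem twistedStarId_eq_zero {Θ : ExternalChange T} {Γ : Graph T} (hΓ : Γ.IsFeynman)
    (hoverlap : ∀ S ∈ Γ.parts, ∀ S' ∈ Γ.parts, (Γ.sub S).legs.card = 2 → NonOverlapping S S')
    (h : Γ.HasSelfEnergyPart) : twistedStarId Θ Γ = 0 := by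
  rw [twistedStarId_eq_add, twistedAntipode_eq_zero hΓ hoverlap h,
    preparation_closed hΓ hoverlap, if_pos h, map_zero, add_zero]

end FeynmanGraphs

end

/-! ### The theorem -/

open FeynmanGraphs in
theorem mainTheorem2 (T : QFT) (Θ : ExternalChange T) (Γ : Graph T) (hΓ : Γ.Is1PI)
    (hoverlap : ∀ S ∈ Γ.parts, ∀ S' ∈ Γ.parts, (Γ.sub S).legs.card = 2 → NonOverlapping S S')
    (σ : ExtStr T.D Γ.legs) :
    bid Θ (specify Θ Γ.legs σ (twistedStarId Θ Γ)) = 0 ∧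
    ((∀ S ∈ Γ.parts, 2 < (Γ.sub S).legs.card) → ¬ SuperficiallyConvergent Γ σ →
      bid Θ (specify Θ Γ.legs σ (twistedAntipode Θ Γ)) = 1) ∧
    ((∃ S ∈ Γ.parts, (Γ.sub S).legs.card = 2) →
      specify Θ Γ.legs σ (twistedAntipode Θ Γ) = 0) := by
  refine ⟨?_, fun hvertex hσ => ?_, fun h => ?_⟩
  -- With a self-energy part the element itself is zero; otherwise it is the forest sum of the
  -- convergent structure `σ - Θσ`.
  · by_cases h : Γ.HasSelfEnergyPart
    · have e : specify Θ Γ.legs σ (twistedStarId Θ Γ) = 0 :=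
        (congrArg (specify Θ Γ.legs σ) (twistedStarId_eq_zero hΓ.feynman hoverlap h)).trans
          (map_zero (specify Θ Γ.legs σ))
      exact (congrArg (bid Θ) e).trans (bid_eq_zero (bidegreeLE Θ 0).zero_mem)
    · refine (congrArg (bid Θ) (specify_twistedStarId hΓ.feynman hoverlap h σ)).trans ?_
      exact bid_eq_zero ((forestElement_bidegree Θ hΓ _).1
        (forestElement_mem_convergentIdeal (superficiallyConvergent_sub_map Θ hΓ σ)))
  · have hno : ¬ Γ.HasSelfEnergyPart := fun ⟨S, hS, hc⟩ => (hvertex S hS).ne' hc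
    have h := forestElement_bidegree Θ hΓ (Θ.map Γ.legs σ)
    refine (congrArg (bid Θ) (specify_twistedAntipode hΓ.feynman hoverlap hno σ)).trans ?_
    exact bid_eq_one h.2.1 (h.2.2 (forestElement_notMem_convergentIdeal Θ hΓ hσ))
  · exact (congrArg (specify Θ Γ.legs σ)
      (twistedAntipode_eq_zero hΓ.feynman hoverlap h)).trans (map_zero (specify Θ Γ.legs σ))
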